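/- Let $0\le d<n$ be integers and let $\mathcal B\subset\mathbb C^{2n}$ be open. A function on an open subset of $\mathbb C^k$ is called *real-holomorphic* if it is holomorphic and real at the real points. Suppose that $a:\mathcal B\to\mathbb C^{2n}$ and $G,J:\mathcal B\to\mathbb C^{2n\times 2n}$ are real-holomorphic, that $\Omega=(Da)^\top-Da$ satisfies $\det\Omega\neq0$ on $\mathcal B$, that $G^\top=G$ on $\mathcal B$ and $G$ is positive definite at the real points, and that $J^2=-I$ and $J^\top\Omega=G$ on $\mathcal B$ (an exact symplectic form with a compatible triple). Let $h_\lambda:\mathcal B\to\mathbb C$, $\lambda\in\Lambda\subset\mathbb R^{n-d}$, be a family of real-holomorphic Hamiltonians, with vector fields $X_{h_\lambda}=\Omega^{-1}(Dh_\lambda)^\top$. Let $\omega\in\mathbb R^d$ and $\beta\in\mathbb R^{n-d}$ satisfy Diophantine–Melnikov conditions of type $(\gamma,\tau)$ with $\gamma>0$, $\tau>d-1$: $\beta_i\ne0$ for all $i$, $|\beta_i|\neq|\beta_j|$ for $i\ne j$, and for all $k\in\mathbb Z^d\setminus\{0\}$ $$|k\cdot\omega|\ge\frac{\gamma}{|k|_1^\tau},\qquad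 |k\cdot\omega-\beta_i|\ge\frac{\gamma}{|k|_1^\tau}\ \ (\text{all } i),\qquad |k\cdot\omega-\beta_i\pm\beta_j|\ge\frac{\gamma}{|k|_1^\tau}\ \ (i\neq j).$$ For $r>0$ let $\mathbb T^d_r=\{\theta\in\mathbb C^d: |\mathrm{Im}\,\theta_i|<r \text{ for all } i\}$, and let $\mathcal A_r$ be the set of real-holomorphic functions on $\mathbb T^d_r$ that are $2\pi$-periodic in each variable; write $\|\cdot\|_r$ for the supremum norm on $\mathbb T^d_r$ (for vectors and matrices, the maximum over the entries). Put $\mathfrak L_\omega u=-Du\cdot\omega$ and, for $\alpha\in\mathbb R^{n-d}$, $$\Gamma_{\alpha,\beta}=\begin{pmatrix}\mathrm{diag}(\alpha)&-\mathrm{diag}(\beta)\\ \mathrm{diag}(\beta)&\mathrm{diag}(\alpha)\end{pmatrix}.$$ For $\lambda\in\Lambda$, a torus $K$ (with $2n$ components in $\mathcal A_\rho$) and a bundle $W$ (a $2n\times2(n-d)$ matrix with entries in $\mathcal A_\rho$), the invariance errors are $$E_K=\mathfrak L_\omega K+X_{h_\lambda}\circ K,\qquad E_W=\mathfrak L_\omega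 W+(DX_{h_\lambda}\circ K)\,W-W\,\Gamma_{\alpha,\beta}.$$ Put $\Omega_{V_1V_2}=V_1^\top(\Omega\circ K)V_2$, $G_{V_1V_2}=V_1^\top(G\circ K)V_2$, $L=DK$, $B=G_{LL}^{-1}$, $C=\Omega_{WW}^{-1}G_{WL}B$, $A=\tfrac12C^\top\Omega_{WW}C$, $N=LA+(J\circ K)LB+WC$, and let $P=(L\ \ N\ \ W)$ be the $2n\times 2n$ matrix map with these column blocks. Fix a compact set $\mathcal K\subset\mathcal B$, numbers $0<\delta<\rho$, and $M\ge0$. Then there are $\varepsilon>0$ and $C_0\ge0$ (depending only on the data fixed so far, not on $K,W,\lambda,\alpha$) such that the following holds for all $\lambda\in\Lambda$, $\alpha\in\mathbb R^{n-d}$ and $K,W$ as above with $K(\mathbb T^d_\rho)\subset\mathcal K$, with $G_{LL}$ and $\Omega_{WW}$ invertible at every point of $\mathbb T^d_\rho$, and with $\|W\|_\rho,\ \|G_{LL}^{-1}\|_\rho,\ \|\Omega_{WW}^{-1}\|_\rho\le M$. If $$\|E_K\|_\rho+\|E_W\|_\rho\le\varepsilon,$$ then $P(\theta)$ is invertible for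 every $\theta\in\mathbb T^d_{\rho-\delta}$, and $$P^{-1}=\begin{pmatrix}N^\top\,\Omega\circ K\\ -L^\top\,\Omega\circ K\\ \Omega_{WW}^{-1}W^\top\,\Omega\circ K\end{pmatrix}+E_{inv},$$ where $E_{inv}$ has entries in $\mathcal A_{\rho-\delta}$ and $\|E_{inv}\|_{\rho-\delta}\le C_0\,(\|E_K\|_\rho+\|E_W\|_\rho)$. -/

import Mathlib

open scoped NNReal ENNReal Matrix

noncomputable section

namespace EllipticTori

/-! ## Real-analytic functions through their holomorphic extensions -/

/-- The inclusion of `ℝ^k` into `ℂ^k`. -/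
def toComplex {k : ℕ} (x : Fin k → ℝ) : Fin k → ℂ := fun i => (x i : ℂ)

/-- `f` is holomorphic on `s ⊆ ℂ^k` and takes real values at the real points of `s`. -/
structure IsRealHolomorphicOn {k : ℕ} (s : Set (Fin k → ℂ)) (f : (Fin k → ℂ) → ℂ) : Prop where
  analytic : AnalyticOnNhd ℂ f s
  real : ∀ x : Fin k → ℝ, toComplex x ∈ s → (f (toComplex x)).im = 0

/-- The complex strip `{θ ∈ ℂ^d : |Im θ_i| < ρ}`, which covers the thickened torus. -/
def strip (d : ℕ) (ρ : ℝ) : Set (Fin d → ℂ) := {θ | ∀ i, |(θ i).im| < ρ}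

/-- Real-analytic functions on the torus `ℝ^d / (2πℤ)^d` that extend holomorphically
to the strip of width `ρ`. -/
structure IsTorusFun {d : ℕ} (ρ : ℝ) (f : (Fin d → ℂ) → ℂ) : Prop where
  holo : IsRealHolomorphicOn (strip d ρ) f
  periodic : ∀ θ ∈ strip d ρ, ∀ i, f (θ + Pi.single i (2 * (Real.pi : ℂ))) = f θ

/-- The sup norm on the strip of width `ρ`, as an extended nonnegative number. -/
def supNorm {d : ℕ} (ρ : ℝ) (f : (Fin d → ℂ) → ℂ) : ℝ≥0∞ := ⨆ θ ∈ strip d ρ, ‖f θ‖ₑ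

/-- The norm of a vector-valued map: the largest norm of a component. -/
def vecNorm {d : ℕ} {ι : Type} (ρ : ℝ) (f : (Fin d → ℂ) → ι → ℂ) : ℝ≥0∞ :=
  ⨆ i, supNorm ρ (fun θ => f θ i)

/-- The norm of a matrix-valued map: the largest norm of an entry. -/
def matNorm {d : ℕ} {ι κ : Type} (ρ : ℝ) (F : (Fin d → ℂ) → Matrix ι κ ℂ) : ℝ≥0∞ :=
  ⨆ i, ⨆ j, supNorm ρ (fun θ => F θ i j)

/-- The Jacobian matrix `(D f)_{ij} = ∂ f_i / ∂ z_j`. -/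
def jac {k l : ℕ} (f : (Fin k → ℂ) → Fin l → ℂ) (z : Fin k → ℂ) : Matrix (Fin l) (Fin k) ℂ :=
  Matrix.of fun i j => fderiv ℂ (fun w => f w i) z (Pi.single j 1)

/-- `𝓛_ω u = - D u · ω`. -/
def lieDeriv {d : ℕ} (ω : Fin d → ℝ) (u : (Fin d → ℂ) → ℂ) (θ : Fin d → ℂ) : ℂ :=
  -(fderiv ℂ u θ (toComplex ω))

/-! ## The symplectic setting -/

/-- The matrix `Ω = (D a)ᵀ - D a` of the exact two-form `d(∑ a_i dz_i)`. -/
def twoForm {k : ℕ} (a : (Fin k → ℂ) → Fin k → ℂ) (z : Fin k → ℂ) : Matrix (Fin k) (Fin k) ℂ :=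
  (jac a z)ᵀ - jac a z

/-- A real-analytic exact symplectic structure with a compatible triple `(Ω, G, J)` on the open set
of real points of `domain ⊆ ℂ^{2n}`, given by its holomorphic extension to `domain`. -/
structure CompatibleTriple (n : ℕ) where
  /-- the complex domain, an open subset of `ℂ^{2n}` -/
  domain : Set (Fin (2 * n) → ℂ)
  /-- the coefficients of the one-form -/
  a : (Fin (2 * n) → ℂ) → Fin (2 * n) → ℂ
  /-- the matrix of the Riemannian metric -/
  G : (Fin (2 * n) → ℂ) → Matrix (Fin (2 * n)) (Fin (2 * n)) ℂ
  /-- the matrix of the almost-complex structure -/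
  J : (Fin (2 * n) → ℂ) → Matrix (Fin (2 * n)) (Fin (2 * n)) ℂ
  isOpen_domain : IsOpen domain
  a_holo : ∀ i, IsRealHolomorphicOn domain (fun z => a z i)
  G_holo : ∀ i j, IsRealHolomorphicOn domain (fun z => G z i j)
  J_holo : ∀ i j, IsRealHolomorphicOn domain (fun z => J z i j)
  /-- the two-form is non-degenerate -/
  nondegenerate : ∀ z ∈ domain, (twoForm a z).det ≠ 0
  G_symm : ∀ z ∈ domain, (G z)ᵀ = G z
  G_posDef : ∀ x : Fin (2 * n) → ℝ, toComplex x ∈ domain →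
    ((G (toComplex x)).map Complex.re).PosDef
  J_sq : ∀ z ∈ domain, J z * J z = -1
  /-- `Ω_z (J_z u, v) = G_z (u, v)` for all `u`, `v` -/
  compatible : ∀ z ∈ domain, (J z)ᵀ * twoForm a z = G z

/-- The matrix of the symplectic form. -/
def CompatibleTriple.Ω {n : ℕ} (S : CompatibleTriple n) (z : Fin (2 * n) → ℂ) :
    Matrix (Fin (2 * n)) (Fin (2 * n)) ℂ :=
  twoForm S.a z

/-- The Hamiltonian vector field `X_h = Ω⁻¹ (D h)ᵀ`. -/
def CompatibleTriple.hamVF {n : ℕ} (S : CompatibleTriple n) (h : (Fin (2 * n) → ℂ) → ℂ)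
    (z : Fin (2 * n) → ℂ) : Fin (2 * n) → ℂ :=
  (S.Ω z)⁻¹ *ᵥ fun j => fderiv ℂ h z (Pi.single j 1)

/-! ## Frequencies -/

/-- Diophantine-Melnikov conditions of type `(γ, τ)`. -/
structure DiophantineMelnikov {d m : ℕ} (ω : Fin d → ℝ) (β : Fin m → ℝ) (γ τ : ℝ) : Prop where
  γ_pos : 0 < γ
  τ_gt : (d : ℝ) - 1 < τ
  β_ne_zero : ∀ i, β i ≠ 0
  β_abs_ne : ∀ i j, i ≠ j → |β i| ≠ |β j|
  diophantine : ∀ k : Fin d → ℤ, k ≠ 0 →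
    γ / (∑ l, |(k l : ℝ)|) ^ τ ≤ |∑ l, (k l : ℝ) * ω l|
  melnikov_one : ∀ k : Fin d → ℤ, k ≠ 0 → ∀ i,
    γ / (∑ l, |(k l : ℝ)|) ^ τ ≤ |(∑ l, (k l : ℝ) * ω l) - β i|
  melnikov_two : ∀ k : Fin d → ℤ, k ≠ 0 → ∀ i j, i ≠ j →
    γ / (∑ l, |(k l : ℝ)|) ^ τ ≤ |(∑ l, (k l : ℝ) * ω l) - β i + β j| ∧
    γ / (∑ l, |(k l : ℝ)|) ^ τ ≤ |(∑ l, (k l : ℝ) * ω l) - β i - β j|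

/-- The matrix `Γ_{α,β}`, of size `2m`. -/
def Gam {m : ℕ} (α β : Fin m → ℝ) : Matrix (Fin m ⊕ Fin m) (Fin m ⊕ Fin m) ℂ :=
  Matrix.fromBlocks (Matrix.diagonal (toComplex α)) (-Matrix.diagonal (toComplex β))
    (Matrix.diagonal (toComplex β)) (Matrix.diagonal (toComplex α))

/-! ## Torus, bundle and the adapted frame -/

variable {n d : ℕ}

/-- The index set of the `2(n-d)` columns of the normal bundle. -/
abbrev NormalIdx (n d : ℕ) : Type := Fin (n - d) ⊕ Fin (n - d)

/-- The index set of the columns of the frame `(L N W)`. -/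
abbrev FrameIdx (n d : ℕ) : Type := Fin d ⊕ (Fin d ⊕ NormalIdx n d)

/-- Maps from the (complexified) torus to `2n × κ` matrices. -/
abbrev MatMap (n d : ℕ) (κ : Type) : Type := (Fin d → ℂ) → Matrix (Fin (2 * n)) κ ℂ

/-- The invariance error `E_K = 𝓛_ω K + X_h ∘ K`. -/
def errK (S : CompatibleTriple n) (h : (Fin (2 * n) → ℂ) → ℂ) (ω : Fin d → ℝ)
    (K : (Fin d → ℂ) → Fin (2 * n) → ℂ) (θ : Fin d → ℂ) : Fin (2 * n) → ℂ :=
  fun i => lieDeriv ω (fun φ => K φ i) θ + S.hamVF h (K θ) i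

/-- The invariance error `E_W = 𝓛_ω W + (D X_h ∘ K) W - W Γ_{α,β}`. -/
def errW (S : CompatibleTriple n) (h : (Fin (2 * n) → ℂ) → ℂ) (ω : Fin d → ℝ)
    (α β : Fin (n - d) → ℝ) (K : (Fin d → ℂ) → Fin (2 * n) → ℂ)
    (W : MatMap n d (NormalIdx n d)) : MatMap n d (NormalIdx n d) :=
  fun θ => (Matrix.of fun i j => lieDeriv ω (fun φ => W φ i j) θ)
    + jac (S.hamVF h) (K θ) * W θ - W θ * Gam α β

/-- `Ω_{V₁V₂} = V₁ᵀ (Ω ∘ K) V₂`. -/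
def pairΩ (S : CompatibleTriple n) (K : (Fin d → ℂ) → Fin (2 * n) → ℂ) {κ₁ κ₂ : Type}
    (V₁ : MatMap n d κ₁) (V₂ : MatMap n d κ₂) (θ : Fin d → ℂ) : Matrix κ₁ κ₂ ℂ :=
  (V₁ θ)ᵀ * S.Ω (K θ) * V₂ θ

/-- `G_{V₁V₂} = V₁ᵀ (G ∘ K) V₂`. -/
def pairG (S : CompatibleTriple n) (K : (Fin d → ℂ) → Fin (2 * n) → ℂ) {κ₁ κ₂ : Type}
    (V₁ : MatMap n d κ₁) (V₂ : MatMap n d κ₂) (θ : Fin d → ℂ) : Matrix κ₁ κ₂ ℂ :=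
  (V₁ θ)ᵀ * S.G (K θ) * V₂ θ

/-- `L = D K`. -/
def frameL (K : (Fin d → ℂ) → Fin (2 * n) → ℂ) : MatMap n d (Fin d) := jac K

/-- `B = G_{LL}⁻¹`. -/
def matB (S : CompatibleTriple n) (K : (Fin d → ℂ) → Fin (2 * n) → ℂ) (θ : Fin d → ℂ) :
    Matrix (Fin d) (Fin d) ℂ :=
  (pairG S K (frameL K) (frameL K) θ)⁻¹

/-- `C = Ω_{WW}⁻¹ G_{WL} B`. -/
def matC (S : CompatibleTriple n) (K : (Fin d → ℂ) → Fin (2 * n) → ℂ)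
    (W : MatMap n d (NormalIdx n d)) (θ : Fin d → ℂ) : Matrix (NormalIdx n d) (Fin d) ℂ :=
  (pairΩ S K W W θ)⁻¹ * pairG S K W (frameL K) θ * matB S K θ

/-- `A = ½ Cᵀ Ω_{WW} C`. -/
def matA (S : CompatibleTriple n) (K : (Fin d → ℂ) → Fin (2 * n) → ℂ)
    (W : MatMap n d (NormalIdx n d)) (θ : Fin d → ℂ) : Matrix (Fin d) (Fin d) ℂ :=
  (1 / 2 : ℂ) • ((matC S K W θ)ᵀ * pairΩ S K W W θ * matC S K W θ)

/-- `N = L A + (J ∘ K) L B + W C`. -/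
def frameN (S : CompatibleTriple n) (K : (Fin d → ℂ) → Fin (2 * n) → ℂ)
    (W : MatMap n d (NormalIdx n d)) : MatMap n d (Fin d) :=
  fun θ => frameL K θ * matA S K W θ + S.J (K θ) * frameL K θ * matB S K θ
    + W θ * matC S K W θ

/-- The frame `P = (L N W)`. -/
def frameP (S : CompatibleTriple n) (K : (Fin d → ℂ) → Fin (2 * n) → ℂ)
    (W : MatMap n d (NormalIdx n d)) : MatMap n d (FrameIdx n d) :=
  fun θ => Matrix.fromCols (frameL K θ) (Matrix.fromCols (frameN S K W θ) (W θ))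

/-- The approximate inverse of `P`, with the row blocks `Nᵀ (Ω ∘ K)`, `-Lᵀ (Ω ∘ K)` and
`Ω_{WW}⁻¹ Wᵀ (Ω ∘ K)`. -/
def approxInv (S : CompatibleTriple n) (K : (Fin d → ℂ) → Fin (2 * n) → ℂ)
    (W : MatMap n d (NormalIdx n d)) (θ : Fin d → ℂ) :
    Matrix (FrameIdx n d) (Fin (2 * n)) ℂ :=
  Matrix.fromRows ((frameN S K W θ)ᵀ * S.Ω (K θ))
    (Matrix.fromRows (-(frameL K θ)ᵀ * S.Ω (K θ))
      ((pairΩ S K W W θ)⁻¹ * (W θ)ᵀ * S.Ω (K θ)))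

end EllipticTori

end

open EllipticTori

/-! Write `X = Lᵀ Ω L` and `Y = Lᵀ Ω W`. The matrices `A`, `B`, `C` are chosen so that, if `X` and
`Y` vanished, the proposed inverse times `P` would be exactly the identity. In general the product
is `1 + D`, where every block of `D` is zero or has `X` or `Y` as a factor
(`IsAdaptedFrame.approxInv_mul`, pure algebra). It remains to show that `X` and `Y` are of the size
of the invariance errors on the smaller strip.

Both satisfy small-divisor equations. `L` and `W` solve the equation linearised along `X_h` up to
errors (and, for `W`, up to `W Γ`), and `Ω` is invariant under the Hamiltonian flow (`lie_Ω`). Hence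
in the derivative of the pairings along `ω` all terms with `D X_h` cancel: `D X · ω` and `D Y · ω +
Y Γ` are bounded by the errors (`matDeriv_pairΩ`). Since no norm of the Hamiltonian survives, the
constants do not depend on `λ`.

On Fourier coefficients these equations become multiplications. For `X` the divisor is `i k·ω`, and
the mean is zero because the pull-back of an exact form is exact. For `Y`, diagonalising `Γ` gives
the divisors `α_i + i (k·ω ∓ β_i)`; their imaginary parts are bounded below by the first Melnikov
condition, and by `|β_i| > 0` when `k = 0`, whatever `α` is. The loss of `|k|^τ` is absorbed by
Cauchy estimates (`exists_norm_le_of_small_divisors`), which cost strip width.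

When the errors are small, `1 + D` is invertible and `(1 + D)⁻¹ - 1` is again of the size of the
errors. As `P` is square, the left inverse obtained this way is the inverse. To keep constants
uniform, all bounds are stated for the whole family `ApproxTorus` by means of `UniformBound`. -/

noncomputable section

namespace EllipticTori

/-! ## Closure properties of real-holomorphic functions -/

namespace IsRealHolomorphicOn

variable {k l : ℕ} {s : Set (Fin k → ℂ)} {f g : (Fin k → ℂ) → ℂ}

theorem mono {t : Set (Fin k → ℂ)} (hf : IsRealHolomorphicOn s f) (hts : t ⊆ s) :
    IsRealHolomorphicOn t f :=
  ⟨hf.analytic.mono hts, fun x hx => hf.real x (hts hx)⟩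

theorem const {c : ℂ} (hc : c.im = 0) : IsRealHolomorphicOn s fun _ => c :=
  ⟨analyticOnNhd_const, fun _ _ => hc⟩

theorem add (hf : IsRealHolomorphicOn s f) (hg : IsRealHolomorphicOn s g) :
    IsRealHolomorphicOn s fun z => f z + g z :=
  ⟨hf.analytic.add hg.analytic, fun x hx => by simp [hf.real x hx, hg.real x hx]⟩

theorem neg (hf : IsRealHolomorphicOn s f) : IsRealHolomorphicOn s fun z => -f z :=
  ⟨hf.analytic.neg, fun x hx => by simp [hf.real x hx]⟩

theorem sub (hf : IsRealHolomorphicOn s f) (hg : IsRealHolomorphicOn s g) :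
    IsRealHolomorphicOn s fun z => f z - g z :=
  ⟨hf.analytic.sub hg.analytic, fun x hx => by simp [hf.real x hx, hg.real x hx]⟩

theorem mul (hf : IsRealHolomorphicOn s f) (hg : IsRealHolomorphicOn s g) :
    IsRealHolomorphicOn s fun z => f z * g z :=
  ⟨hf.analytic.mul hg.analytic, fun x hx => by simp [hf.real x hx, hg.real x hx]⟩

theorem inv (hf : IsRealHolomorphicOn s f) (h0 : ∀ z ∈ s, f z ≠ 0) :
    IsRealHolomorphicOn s fun z => (f z)⁻¹ :=
  ⟨hf.analytic.inv h0, fun x hx => by simp [hf.real x hx]⟩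

theorem sum {ι : Type*} (t : Finset ι) {F : ι → (Fin k → ℂ) → ℂ}
    (hF : ∀ i ∈ t, IsRealHolomorphicOn s (F i)) :
    IsRealHolomorphicOn s fun z => ∑ i ∈ t, F i z := by
  classical
  induction t using Finset.induction_on with
  | empty => simpa using const (s := s) Complex.zero_im
  | insert a t ha ih =>
    simp only [Finset.sum_insert ha]
    exact (hF a (by simp)).add (ih fun i hi => hF i (by simp [hi]))

theorem prod {ι : Type*} (t : Finset ι) {F : ι → (Fin k → ℂ) → ℂ}
    (hF : ∀ i ∈ t, IsRealHolomorphicOn s (F i)) :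
    IsRealHolomorphicOn s fun z => ∏ i ∈ t, F i z := by
  classical
  induction t using Finset.induction_on with
  | empty => simpa using const (s := s) Complex.one_im
  | insert a t ha ih =>
    simp only [Finset.prod_insert ha]
    exact (hF a (by simp)).mul (ih fun i hi => hF i (by simp [hi]))

theorem comp {t : Set (Fin l → ℂ)} {F : (Fin l → ℂ) → ℂ} {u : (Fin k → ℂ) → Fin l → ℂ}
    (hF : IsRealHolomorphicOn t F) (hu : ∀ i, IsRealHolomorphicOn s fun z => u z i)
    (hst : ∀ z ∈ s, u z ∈ t) : IsRealHolomorphicOn s fun z => F (u z) := by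
  refine ⟨hF.analytic.comp (AnalyticOnNhd.pi fun i => (hu i).analytic) hst, fun x hx => ?_⟩
  have : u (toComplex x) = toComplex fun i => (u (toComplex x) i).re := by
    ext i
    exact Complex.ext (by simp [toComplex]) (by simp [toComplex, (hu i).real x hx])
  have h2 := hst _ hx
  rw [this] at h2 ⊢
  exact hF.real _ h2

theorem differentiableAt (hf : IsRealHolomorphicOn s f) {z : Fin k → ℂ} (hz : z ∈ s) :
    DifferentiableAt ℂ f z :=
  (hf.analytic z hz).differentiableAt

/-- For reality: on a real line through a real point `Im f` vanishes near that point because `s` is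
open, so its derivative along the line is zero. -/
theorem fderiv_apply (hf : IsRealHolomorphicOn s f) (hs : IsOpen s) (v : Fin k → ℝ) :
    IsRealHolomorphicOn s fun z => fderiv ℂ f z (toComplex v) := by
  refine ⟨fun z hz => ?_, fun x hx => ?_⟩
  · exact (ContinuousLinearMap.apply ℂ ℂ (toComplex v)).analyticAt _ |>.comp
      (hf.analytic.fderiv z hz)
  · let c : ℝ → Fin k → ℂ := fun t => toComplex (x + t • v)
    have hc : HasDerivAt c (toComplex v) 0 := by
      rw [hasDerivAt_pi]
      intro i
      have h1 : HasDerivAt (fun t : ℝ => x i + t * v i) (v i) 0 := by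
        simpa using ((hasDerivAt_id (0 : ℝ)).mul_const (v i)).const_add (x i)
      simpa [c, toComplex] using h1.ofReal_comp
    have hc0 : c 0 = toComplex x := by simp [c]
    have h1 : HasDerivAt (fun t => f (c t)) (fderiv ℂ f (toComplex x) (toComplex v)) 0 := by
      have hd := ((hf.differentiableAt hx).hasFDerivAt.restrictScalars ℝ)
      rw [← hc0] at hd
      have := hd.comp_hasDerivAt (0 : ℝ) hc
      rw [hc0] at this
      exact this
    have h2 : HasDerivAt (fun t => (f (c t)).im)
        (fderiv ℂ f (toComplex x) (toComplex v)).im 0 :=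
      Complex.imCLM.hasFDerivAt.comp_hasDerivAt (0 : ℝ) h1
    have h3 : (fun t => (f (c t)).im) =ᶠ[nhds 0] fun _ => (0 : ℝ) := by
      have : ∀ᶠ t in nhds (0 : ℝ), c t ∈ s :=
        hc.continuousAt.eventually_mem (by rw [hc0]; exact hs.mem_nhds hx)
      filter_upwards [this] with t ht using hf.real _ ht
    exact h2.unique ((hasDerivAt_const (0 : ℝ) (0 : ℝ)).congr_of_eventuallyEq h3)

end IsRealHolomorphicOn

theorem toComplex_single {k : ℕ} (j : Fin k) :
    toComplex (Pi.single j 1) = (Pi.single j 1 : Fin k → ℂ) := by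
  ext i
  by_cases h : i = j
  · subst h; simp [toComplex]
  · simp [toComplex, h]

theorem IsRealHolomorphicOn.partialDeriv {k : ℕ} {s : Set (Fin k → ℂ)} {f : (Fin k → ℂ) → ℂ}
    (hf : IsRealHolomorphicOn s f) (hs : IsOpen s) (j : Fin k) :
    IsRealHolomorphicOn s fun z => fderiv ℂ f z (Pi.single j 1) := by
  simpa only [toComplex_single] using hf.fderiv_apply hs (Pi.single j 1)

/-- A matrix-valued map all of whose entries are real-holomorphic. -/
def MatHolo {k : ℕ} {ι κ : Type} (s : Set (Fin k → ℂ)) (F : (Fin k → ℂ) → Matrix ι κ ℂ) : Prop :=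
  ∀ i j, IsRealHolomorphicOn s fun z => F z i j

namespace MatHolo

variable {k : ℕ} {ι κ μ : Type} {s : Set (Fin k → ℂ)}

theorem mono {t : Set (Fin k → ℂ)} {F : (Fin k → ℂ) → Matrix ι κ ℂ} (hF : MatHolo s F)
    (hts : t ⊆ s) : MatHolo t F := fun i j => (hF i j).mono hts

theorem add {F G : (Fin k → ℂ) → Matrix ι κ ℂ} (hF : MatHolo s F) (hG : MatHolo s G) :
    MatHolo s fun z => F z + G z := fun i j => (hF i j).add (hG i j)

theorem sub {F G : (Fin k → ℂ) → Matrix ι κ ℂ} (hF : MatHolo s F) (hG : MatHolo s G) :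
    MatHolo s fun z => F z - G z := fun i j => (hF i j).sub (hG i j)

theorem neg {F : (Fin k → ℂ) → Matrix ι κ ℂ} (hF : MatHolo s F) :
    MatHolo s fun z => -F z := fun i j => (hF i j).neg

theorem transpose {F : (Fin k → ℂ) → Matrix ι κ ℂ} (hF : MatHolo s F) :
    MatHolo s fun z => (F z)ᵀ := fun i j => hF j i

theorem mul [Fintype κ] {F : (Fin k → ℂ) → Matrix ι κ ℂ} {G : (Fin k → ℂ) → Matrix κ μ ℂ}
    (hF : MatHolo s F) (hG : MatHolo s G) : MatHolo s fun z => F z * G z := fun i j => by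
  simp only [Matrix.mul_apply]
  exact .sum _ fun l _ => (hF i l).mul (hG l j)

theorem smul {F : (Fin k → ℂ) → Matrix ι κ ℂ} {c : ℂ} (hc : c.im = 0) (hF : MatHolo s F) :
    MatHolo s fun z => c • F z := fun i j => (IsRealHolomorphicOn.const hc).mul (hF i j)

theorem fromCols {F : (Fin k → ℂ) → Matrix ι κ ℂ} {G : (Fin k → ℂ) → Matrix ι μ ℂ}
    (hF : MatHolo s F) (hG : MatHolo s G) :
    MatHolo s fun z => Matrix.fromCols (F z) (G z) := by
  rintro i (j | j)
  · exact hF i j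
  · exact hG i j

theorem fromRows {F : (Fin k → ℂ) → Matrix ι κ ℂ} {G : (Fin k → ℂ) → Matrix μ κ ℂ}
    (hF : MatHolo s F) (hG : MatHolo s G) :
    MatHolo s fun z => Matrix.fromRows (F z) (G z) := by
  rintro (i | i) j
  · exact hF i j
  · exact hG i j

theorem comp {l : ℕ} {t : Set (Fin l → ℂ)} {F : (Fin l → ℂ) → Matrix ι κ ℂ}
    {u : (Fin k → ℂ) → Fin l → ℂ} (hF : MatHolo t F)
    (hu : ∀ i, IsRealHolomorphicOn s fun z => u z i) (hst : ∀ z ∈ s, u z ∈ t) :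
    MatHolo s fun z => F (u z) := fun i j => (hF i j).comp hu hst

theorem det [Fintype ι] [DecidableEq ι] {F : (Fin k → ℂ) → Matrix ι ι ℂ} (hF : MatHolo s F) :
    IsRealHolomorphicOn s fun z => (F z).det := by
  simp only [Matrix.det_apply']
  exact .sum _ fun σ _ => (IsRealHolomorphicOn.const (by simp)).mul (.prod _ fun i _ => hF _ _)

theorem inv [Fintype ι] [DecidableEq ι] {F : (Fin k → ℂ) → Matrix ι ι ℂ} (hF : MatHolo s F)
    (hdet : ∀ z ∈ s, (F z).det ≠ 0) : MatHolo s fun z => (F z)⁻¹ := by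
  intro i j
  simp only [Matrix.inv_def, Ring.inverse_eq_inv', Matrix.smul_apply, smul_eq_mul,
    Matrix.adjugate_apply]
  refine (hF.det.inv hdet).mul (det fun a b => ?_)
  by_cases h : a = j
  · subst h
    simp only [Matrix.updateRow_self]
    refine .const ?_
    by_cases h : b = i
    · subst h; simp
    · simp [h]
  · simpa only [Matrix.updateRow_ne h] using hF a b

end MatHolo

theorem matHolo_jac {k l : ℕ} {s : Set (Fin k → ℂ)} (hs : IsOpen s)
    {f : (Fin k → ℂ) → Fin l → ℂ} (hf : ∀ i, IsRealHolomorphicOn s fun z => f z i) :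
    MatHolo s (jac f) := fun i j => (hf i).partialDeriv hs j

/-! ## The strip -/

theorem isOpen_strip (d : ℕ) (r : ℝ) : IsOpen (strip d r) := by
  have : strip d r = ⋂ i, {θ : Fin d → ℂ | |(θ i).im| < r} := by ext; simp [strip]
  rw [this]
  exact isOpen_iInter_of_finite fun i => isOpen_lt (by fun_prop) continuous_const

theorem strip_mono {d : ℕ} {r r' : ℝ} (h : r' ≤ r) : strip d r' ⊆ strip d r :=
  fun _ hθ i => (hθ i).trans_le h

/-- A derivative of a function that is periodic on the strip is periodic. -/
theorem fderiv_periodic {d : ℕ} {r : ℝ} {f : (Fin d → ℂ) → ℂ} {i : Fin d}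
    (hf : ∀ θ ∈ strip d r, f (θ + Pi.single i (2 * (Real.pi : ℂ))) = f θ)
    {θ : Fin d → ℂ} (hθ : θ ∈ strip d r) :
    fderiv ℂ f (θ + Pi.single i (2 * (Real.pi : ℂ))) = fderiv ℂ f θ := by
  rw [← fderiv_comp_add_right]
  refine Filter.EventuallyEq.fderiv_eq ?_
  filter_upwards [(isOpen_strip d r).mem_nhds hθ] with φ hφ using hf φ hφ

/-! ## Cauchy estimates on strips -/

/-- Cauchy's one-variable estimate on the disc of radius `(r - r') / 2` about `θ` in the `j`-th
coordinate, which stays in the larger strip. -/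
theorem norm_partialDeriv_le {d : ℕ} {r r' c : ℝ} (hr : r' < r) {f : (Fin d → ℂ) → ℂ}
    (hf : AnalyticOnNhd ℂ f (strip d r)) (hc : ∀ θ ∈ strip d r, ‖f θ‖ ≤ c) (j : Fin d)
    {θ : Fin d → ℂ} (hθ : θ ∈ strip d r') :
    ‖fderiv ℂ f θ (Pi.single j 1)‖ ≤ 2 / (r - r') * c := by
  have hR : 0 < (r - r') / 2 := by linarith
  set u : ℂ → Fin d → ℂ := fun t => θ + t • Pi.single j 1 with hu
  have hmem : ∀ t ∈ Metric.closedBall (0 : ℂ) ((r - r') / 2), u t ∈ strip d r := by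
    intro t ht i
    rw [mem_closedBall_zero_iff] at ht
    have h1 : |(u t i).im| ≤ |(θ i).im| + ‖t‖ := by
      by_cases h : i = j
      · subst h
        simpa [hu] using (abs_add_le _ _).trans
          (add_le_add_right (Complex.abs_im_le_norm t) |(θ i).im|)
      · simp [hu, h]
    have := hθ i
    linarith
  have hud : ∀ t, HasDerivAt u (Pi.single j 1) t := fun t => by
    simpa [hu] using ((hasDerivAt_id t).smul_const (Pi.single j (1 : ℂ))).const_add θ
  have hd : ∀ t ∈ Metric.closedBall (0 : ℂ) ((r - r') / 2),
      HasDerivAt (fun t => f (u t)) (fderiv ℂ f (u t) (Pi.single j 1)) t := fun t ht =>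
    (hf _ (hmem t ht)).differentiableAt.hasFDerivAt.comp_hasDerivAt t (hud t)
  have h0 : u 0 = θ := by simp [hu]
  have h1 : ‖deriv (fun t => f (u t)) 0‖ ≤ c / ((r - r') / 2) := by
    refine Complex.norm_deriv_le_of_forall_mem_sphere_norm_le hR ?_ fun t ht =>
      hc _ (hmem t (Metric.sphere_subset_closedBall ht))
    refine DifferentiableOn.diffContOnCl_ball (U := Metric.closedBall 0 ((r - r') / 2))
      (fun t ht => (hd t ht).differentiableAt.differentiableWithinAt) subset_rfl
  rw [(hd 0 (by simp [hR.le])).deriv, h0] at h1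
  refine h1.trans (le_of_eq ?_)
  field_simp

theorem AnalyticOnNhd.partialDeriv {d : ℕ} {s : Set (Fin d → ℂ)} {f : (Fin d → ℂ) → ℂ}
    (hf : AnalyticOnNhd ℂ f s) (v : Fin d → ℂ) :
    AnalyticOnNhd ℂ (fun θ => fderiv ℂ f θ v) s := fun z hz =>
  (ContinuousLinearMap.apply ℂ ℂ v).analyticAt _ |>.comp (hf.fderiv z hz)

/-- Functions that are holomorphic on a strip and `2π`-periodic in each variable. -/
structure IsPeriodicHolo {d : ℕ} (r : ℝ) (f : (Fin d → ℂ) → ℂ) : Prop where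
  analytic : AnalyticOnNhd ℂ f (strip d r)
  periodic : ∀ θ ∈ strip d r, ∀ i, f (θ + Pi.single i (2 * (Real.pi : ℂ))) = f θ

namespace IsPeriodicHolo

variable {d : ℕ} {r : ℝ} {f g : (Fin d → ℂ) → ℂ}

theorem mono {r' : ℝ} (hf : IsPeriodicHolo r f) (h : r' ≤ r) : IsPeriodicHolo r' f :=
  ⟨hf.analytic.mono (strip_mono h), fun θ hθ => hf.periodic θ (strip_mono h hθ)⟩

theorem fderiv_apply (hf : IsPeriodicHolo r f) (v : Fin d → ℂ) :
    IsPeriodicHolo r fun θ => fderiv ℂ f θ v :=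
  ⟨AnalyticOnNhd.partialDeriv hf.analytic v, fun θ hθ i => by
    rw [fderiv_periodic (fun θ hθ => hf.periodic θ hθ i) hθ]⟩

theorem add (hf : IsPeriodicHolo r f) (hg : IsPeriodicHolo r g) :
    IsPeriodicHolo r fun θ => f θ + g θ :=
  ⟨hf.analytic.add hg.analytic, fun θ hθ i => by rw [hf.periodic θ hθ, hg.periodic θ hθ]⟩

theorem mul (hf : IsPeriodicHolo r f) (hg : IsPeriodicHolo r g) :
    IsPeriodicHolo r fun θ => f θ * g θ :=
  ⟨hf.analytic.mul hg.analytic, fun θ hθ i => by rw [hf.periodic θ hθ, hg.periodic θ hθ]⟩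

theorem const_mul (c : ℂ) (hf : IsPeriodicHolo r f) : IsPeriodicHolo r fun θ => c * f θ :=
  ⟨analyticOnNhd_const.mul hf.analytic, fun θ hθ i => by rw [hf.periodic θ hθ]⟩

theorem sum {ι : Type*} (t : Finset ι) {F : ι → (Fin d → ℂ) → ℂ}
    (hF : ∀ i ∈ t, IsPeriodicHolo r (F i)) : IsPeriodicHolo r fun z => ∑ i ∈ t, F i z :=
  ⟨t.analyticOnNhd_fun_sum fun i hi => (hF i hi).analytic, fun θ hθ i =>
    Finset.sum_congr rfl fun j hj => (hF j hj).periodic θ hθ i⟩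

end IsPeriodicHolo

/-- Cauchy estimate for iterated partial derivatives. -/
theorem exists_norm_iterate_partialDeriv_le {d : ℕ} (m : ℕ) {r r' : ℝ} (hr : r' < r) :
    ∃ C : ℝ, 0 ≤ C ∧ ∀ (j : Fin d) (f : (Fin d → ℂ) → ℂ) (c : ℝ), IsPeriodicHolo r f →
      (∀ θ ∈ strip d r, ‖f θ‖ ≤ c) →
      IsPeriodicHolo r ((fun g θ => fderiv ℂ g θ (Pi.single j 1))^[m] f) ∧
      ∀ θ ∈ strip d r', ‖((fun g θ => fderiv ℂ g θ (Pi.single j 1))^[m] f) θ‖ ≤ C * c := by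
  induction m generalizing r' with
  | zero =>
    exact ⟨1, zero_le_one, fun j f c hf hc =>
      ⟨hf, fun θ hθ => by simpa using hc θ (strip_mono hr.le hθ)⟩⟩
  | succ m ih =>
    -- Half of the width is spent on the first `m` derivatives and the other half on the last one.
    obtain ⟨C, hC0, hC⟩ := ih (r' := (r + r') / 2) (by linarith)
    refine ⟨2 / ((r + r') / 2 - r') * C, mul_nonneg (div_nonneg zero_le_two (by linarith)) hC0,
      fun j f c hf hc => ?_⟩
    obtain ⟨h1, h2⟩ := hC j f c hf hc
    simp only [Function.iterate_succ_apply']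
    refine ⟨h1.fderiv_apply _, fun θ hθ => ?_⟩
    rw [mul_assoc]
    exact norm_partialDeriv_le (by linarith)
      (h1.mono (show (r + r') / 2 ≤ r by linarith)).analytic h2 j hθ

end EllipticTori

namespace EllipticTori

/-! ## Fourier coefficients of periodic functions of several real variables -/

section Fourier

open MeasureTheory UnitAddTorus

local instance : MeasureSpace UnitAddCircle := ⟨AddCircle.haarAddCircle⟩

local instance : Measure.IsAddHaarMeasure (volume : Measure UnitAddCircle) :=
  inferInstanceAs (Measure.IsAddHaarMeasure AddCircle.haarAddCircle)

local instance : IsProbabilityMeasure (volume : Measure UnitAddCircle) :=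
  inferInstanceAs (IsProbabilityMeasure AddCircle.haarAddCircle)

variable {d : ℕ}

/-- Continuous functions on `ℝ^d` that are `2π`-periodic in each variable. -/
structure IsContPeriodic (g : (Fin d → ℝ) → ℂ) : Prop where
  continuous : Continuous g
  periodic : ∀ x i, g (x + Pi.single i (2 * Real.pi)) = g x

/-- The function on the unit torus induced by a function on `ℝ^d`. -/
def torusLift (g : (Fin d → ℝ) → ℂ) (t : UnitAddTorus (Fin d)) : ℂ :=
  g fun i => 2 * Real.pi * (AddCircle.equivIco 1 0 (t i) : ℝ)

theorem IsContPeriodic.sub_int {g : (Fin d → ℝ) → ℂ} (hg : IsContPeriodic g) (x : Fin d → ℝ)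
    (k : Fin d → ℤ) : g (fun i => x i - 2 * Real.pi * k i) = g x := by
  have key : ∀ s : Finset (Fin d),
      Function.Periodic g (∑ i ∈ s, k i • Pi.single i (2 * Real.pi)) := by
    intro s
    classical
    induction s using Finset.induction_on with
    | empty => intro x; simp
    | insert a s ha ih =>
      rw [Finset.sum_insert ha]
      exact Function.Periodic.add_period
        (Function.Periodic.zsmul (fun x => hg.periodic x a) (k a)) ih
  have h := key Finset.univ (fun i => x i - 2 * Real.pi * k i)
  rw [← h]
  congr 1
  ext i
  simp only [Pi.add_apply, Finset.sum_apply, zsmul_eq_mul]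
  rw [Finset.sum_eq_single i (fun b _ hb => by simp [hb.symm]) (by simp)]
  simp
  ring

theorem IsContPeriodic.torusLift_coe {g : (Fin d → ℝ) → ℂ} (hg : IsContPeriodic g)
    (x : Fin d → ℝ) :
    torusLift g (fun i => (x i : UnitAddCircle)) = g fun i => 2 * Real.pi * x i := by
  rw [← hg.sub_int (fun i => 2 * Real.pi * x i) fun i => ⌊x i⌋]
  unfold torusLift
  congr 1
  ext i
  have := AddCircle.coe_equivIco_mk_apply (1 : ℝ) (x i)
  simp only [div_one, mul_one] at this
  rw [← mul_sub, Int.self_sub_floor, ← this]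

theorem isOpenQuotientMap_coe_unitAddTorus :
    IsOpenQuotientMap fun (x : Fin d → ℝ) =>
      (fun i => (x i : UnitAddCircle) : UnitAddTorus (Fin d)) :=
  IsOpenQuotientMap.piMap fun _ => QuotientAddGroup.isOpenQuotientMap_mk

/-- The representative in `[0, 1)` jumps at the endpoint, so continuity is checked after composing
with the quotient map from `ℝ^d`, where periodicity removes the jump. -/
theorem IsContPeriodic.continuous_torusLift {g : (Fin d → ℝ) → ℂ} (hg : IsContPeriodic g) :
    Continuous (torusLift g) := by
  rw [isOpenQuotientMap_coe_unitAddTorus.isQuotientMap.continuous_iff]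
  have : (torusLift g ∘ fun (x : Fin d → ℝ) => (fun i => (x i : UnitAddCircle))) =
      fun x => g fun i => 2 * Real.pi * x i := funext fun x => hg.torusLift_coe x
  rw [this]
  exact hg.continuous.comp (by fun_prop)

/-- The Fourier coefficient of a `2π`-periodic function. -/
def coef (g : (Fin d → ℝ) → ℂ) (k : Fin d → ℤ) : ℂ := mFourierCoeff (torusLift g) k

theorem norm_mFourier_apply (k : Fin d → ℤ) (t : UnitAddTorus (Fin d)) : ‖mFourier k t‖ = 1 := by
  simp only [mFourier, fourier_apply, ContinuousMap.coe_mk, norm_prod, Circle.norm_coe,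
    Finset.prod_const_one]

theorem IsContPeriodic.integrable {g : (Fin d → ℝ) → ℂ} (hg : IsContPeriodic g)
    (k : Fin d → ℤ) : Integrable fun t => mFourier (-k) t • torusLift g t :=
  ((mFourier (-k)).continuous.smul hg.continuous_torusLift).integrable_of_hasCompactSupport
    (HasCompactSupport.of_compactSpace _)

theorem norm_coef_le {g : (Fin d → ℝ) → ℂ} {c : ℝ} (hc : ∀ x, ‖g x‖ ≤ c) (k : Fin d → ℤ) :
    ‖coef g k‖ ≤ c := by
  refine (norm_integral_le_of_norm_le_const (C := c)
    (Filter.Eventually.of_forall fun t => ?_)).trans (by simp)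
  rw [norm_smul, norm_mFourier_apply, one_mul]
  exact hc _

theorem coef_add {g g' : (Fin d → ℝ) → ℂ} (hg : IsContPeriodic g) (hg' : IsContPeriodic g')
    (k : Fin d → ℤ) : coef (fun x => g x + g' x) k = coef g k + coef g' k := by
  unfold coef mFourierCoeff
  rw [← integral_add (hg.integrable k) (hg'.integrable k)]
  simp only [torusLift, smul_add]

theorem coef_const_mul (g : (Fin d → ℝ) → ℂ) (c : ℂ) (k : Fin d → ℤ) :
    coef (fun x => c * g x) k = c * coef g k := by
  unfold coef mFourierCoeff
  rw [← integral_const_mul]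
  simp only [torusLift, smul_eq_mul, mul_left_comm]

/-- With absolutely summable coefficients the Fourier series converges to `g` at every point, and
each character has modulus one. -/
theorem norm_le_tsum_of_norm_coef_le {g : (Fin d → ℝ) → ℂ} (hg : IsContPeriodic g)
    {b : (Fin d → ℤ) → ℝ} (hb : Summable b) (h : ∀ k, ‖coef g k‖ ≤ b k) (x : Fin d → ℝ) :
    ‖g x‖ ≤ ∑' k, b k := by
  let f : C(UnitAddTorus (Fin d), ℂ) := ⟨torusLift g, hg.continuous_torusLift⟩
  have hs : Summable (mFourierCoeff f) := .of_norm_bounded hb h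
  have h1 := hasSum_mFourier_series_apply_of_summable hs
    fun i => ((x i / (2 * Real.pi) : ℝ) : UnitAddCircle)
  have h2 : f (fun i => ((x i / (2 * Real.pi) : ℝ) : UnitAddCircle)) = g x := by
    refine (hg.torusLift_coe _).trans ?_
    congr 1
    ext i
    field_simp
  rw [h2] at h1
  rw [← h1.tsum_eq]
  refine tsum_of_norm_bounded hb.hasSum fun k => ?_
  rw [norm_smul, norm_mFourier_apply, mul_one]
  exact h k

theorem mFourier_apply_add (k : Fin d → ℤ) (s t : UnitAddTorus (Fin d)) :
    mFourier k (s + t) = mFourier k s * mFourier k t := by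
  simp [mFourier, fourier_apply, AddCircle.toCircle_add, Finset.prod_mul_distrib]

theorem mFourier_neg_neg (k : Fin d → ℤ) (t : UnitAddTorus (Fin d)) :
    mFourier (-k) (-t) = mFourier k t := by
  simp [mFourier, fourier_apply]

theorem mFourier_coe (k : Fin d → ℤ) (x : Fin d → ℝ) :
    mFourier k (fun i => (x i : UnitAddCircle)) =
      Complex.exp (2 * Real.pi * Complex.I * ∑ i, (k i : ℂ) * (x i : ℂ)) := by
  simp only [mFourier, ContinuousMap.coe_mk, fourier_coe_apply, ← Complex.exp_sum, Finset.mul_sum]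
  congr 1
  refine Finset.sum_congr rfl fun i _ => ?_
  simp
  ring

/-- The Fourier coefficients of a directional derivative. -/
theorem coef_deriv {g g' : (Fin d → ℝ) → ℂ} (hg : IsContPeriodic g) (hg' : IsContPeriodic g')
    (w : Fin d → ℝ) (hd : ∀ x, HasDerivAt (fun s : ℝ => g (x + s • w)) (g' x) 0)
    (k : Fin d → ℤ) : coef g' k = Complex.I * (∑ i, (k i : ℂ) * (w i : ℂ)) * coef g k := by
  have hd' : ∀ (x : Fin d → ℝ) (s : ℝ),
      HasDerivAt (fun s : ℝ => g (x + s • w)) (g' (x + s • w)) s := by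
    intro x s
    have h1 := HasDerivAt.comp_sub_const s s
      (by simpa using hd (x + s • w))
    refine h1.congr_of_eventuallyEq (Filter.Eventually.of_forall fun u => ?_)
    simp only
    congr 1
    module
  let p : ℝ → UnitAddTorus (Fin d) := fun s i => ((s * w i / (2 * Real.pi) : ℝ) : UnitAddCircle)
  have hlift : ∀ {f : (Fin d → ℝ) → ℂ}, IsContPeriodic f → ∀ (x : Fin d → ℝ) (s : ℝ),
      torusLift f ((fun i => (x i : UnitAddCircle)) + p s) =
        f ((fun i => 2 * Real.pi * x i) + s • w) := by
    intro f hf x s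
    have : ((fun i => (x i : UnitAddCircle)) + p s) =
        fun i => ((x i + s * w i / (2 * Real.pi) : ℝ) : UnitAddCircle) := by
      ext i; simp [p]
    rw [this, hf.torusLift_coe]
    congr 1
    ext i
    simp
    field_simp
  have hp0 : p 0 = 0 := by ext i; simp [p]
  obtain ⟨c, hc⟩ := isCompact_univ.exists_bound_of_continuousOn
    hg'.continuous_torusLift.continuousOn
  -- The coefficient of the translate of `g` by `s w` is differentiated at `s = 0` in two ways:
  -- under the integral here, and below as an explicit exponential in `s`.
  have h1 := hasDerivAt_integral_of_dominated_loc_of_deriv_le (μ := volume) (x₀ := (0 : ℝ))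
    (s := Set.univ) (F := fun s t => mFourier (-k) t • torusLift g (t + p s))
    (F' := fun s t => mFourier (-k) t • torusLift g' (t + p s)) (bound := fun _ => c)
    Filter.univ_mem
    (Filter.Eventually.of_forall fun s => ((mFourier (-k)).continuous.smul
      (hg.continuous_torusLift.comp (continuous_add_const (p s)))).aestronglyMeasurable)
    (by simpa [hp0] using hg.integrable k)
    (by simpa [hp0] using (hg'.integrable k).aestronglyMeasurable)
    (Filter.Eventually.of_forall fun t s _ => by
      rw [norm_smul, norm_mFourier_apply, one_mul]; exact hc _ (Set.mem_univ _))
    (integrable_const c)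
    (Filter.Eventually.of_forall fun t s _ => by
      obtain ⟨x, rfl⟩ := isOpenQuotientMap_coe_unitAddTorus.surjective t
      simp only [hlift hg, hlift hg']
      exact (hd' _ s).const_mul _)
  -- Translation invariance of Haar measure moves the shift onto the character, which is
  -- multiplicative.
  have h2 : ∀ s : ℝ, ∫ t, mFourier (-k) t • torusLift g (t + p s) =
      Complex.exp (s * (Complex.I * (∑ i, (k i : ℂ) * (w i : ℂ)))) * coef g k := by
    intro s
    have h3 := integral_add_right_eq_self (μ := volume)
      (fun t => mFourier (-k) (t + -p s) • torusLift g t) (p s)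
    simp only [add_neg_cancel_right] at h3
    rw [h3, coef, mFourierCoeff, ← integral_const_mul]
    refine integral_congr_ae (Filter.Eventually.of_forall fun t => ?_)
    simp only [mFourier_apply_add, mFourier_neg_neg, p, mFourier_coe, smul_eq_mul]
    rw [mul_comm (mFourier (-k) t), mul_assoc]
    congr 2
    rw [Finset.mul_sum, Finset.mul_sum, Finset.mul_sum]
    refine Finset.sum_congr rfl fun i _ => ?_
    have : (Real.pi : ℂ) ≠ 0 := by exact_mod_cast Real.pi_ne_zero
    push_cast
    field_simp
  have h4 := h1.2
  simp only [h2, hp0, add_zero] at h4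
  have h5 : HasDerivAt (fun s : ℝ => Complex.exp (s * (Complex.I * (∑ i, (k i : ℂ) * (w i : ℂ)))) *
      coef g k) (Complex.I * (∑ i, (k i : ℂ) * (w i : ℂ)) * coef g k) 0 := by
    have h6 : HasDerivAt (fun s : ℝ => (s : ℂ) * (Complex.I * (∑ i, (k i : ℂ) * (w i : ℂ))))
        (Complex.I * (∑ i, (k i : ℂ) * (w i : ℂ))) 0 := by
      simpa using (Complex.ofRealCLM.hasDerivAt (x := (0 : ℝ))).mul_const
        (Complex.I * (∑ i, (k i : ℂ) * (w i : ℂ)))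
    simpa using h6.cexp.mul_const (coef g k)
  exact h4.unique h5

end Fourier

end EllipticTori

namespace EllipticTori

/-! ## Small divisors -/

variable {d : ℕ}

/-- The restriction of `f` to the real slice with imaginary part `y`. -/
def slice (f : (Fin d → ℂ) → ℂ) (y : Fin d → ℝ) (x : Fin d → ℝ) : ℂ :=
  f (toComplex x + fun i => y i * Complex.I)

theorem slice_mem_strip {r : ℝ} {y : Fin d → ℝ} (hy : ∀ i, |y i| < r) (x : Fin d → ℝ) :
    (toComplex x + fun i => (y i : ℂ) * Complex.I) ∈ strip d r := fun i => by
  simpa [toComplex] using hy i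

namespace IsPeriodicHolo

variable {r : ℝ} {f : (Fin d → ℂ) → ℂ}

theorem isContPeriodic_slice (hf : IsPeriodicHolo r f) {y : Fin d → ℝ} (hy : ∀ i, |y i| < r) :
    IsContPeriodic (slice f y) := by
  refine ⟨hf.analytic.continuousOn.comp_continuous ?_ fun x => slice_mem_strip hy x,
    fun x i => ?_⟩
  · unfold toComplex; fun_prop
  · unfold slice
    rw [← hf.periodic _ (slice_mem_strip hy x) i]
    congr 1
    ext j
    by_cases h : j = i
    · subst h; simp [toComplex]; ring
    · simp [toComplex, h]

theorem coef_slice_fderiv (hf : IsPeriodicHolo r f) {y : Fin d → ℝ} (hy : ∀ i, |y i| < r)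
    (w : Fin d → ℝ) (k : Fin d → ℤ) :
    coef (slice (fun θ => fderiv ℂ f θ (toComplex w)) y) k =
      Complex.I * (∑ i, (k i : ℂ) * (w i : ℂ)) * coef (slice f y) k := by
  refine coef_deriv (hf.isContPeriodic_slice hy)
    ((hf.fderiv_apply _).isContPeriodic_slice hy) w (fun x => ?_) k
  have hc : HasDerivAt (fun s : ℝ => toComplex (x + s • w) + fun i => (y i : ℂ) * Complex.I)
      (toComplex w) 0 := by
    rw [hasDerivAt_pi]
    intro i
    have h1 : HasDerivAt (fun t : ℝ => x i + t * w i) (w i) 0 := by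
      simpa using ((hasDerivAt_id (0 : ℝ)).mul_const (w i)).const_add (x i)
    simpa [toComplex] using h1.ofReal_comp.add_const (y i * Complex.I)
  have hd := ((hf.analytic _ (slice_mem_strip hy
    (x + (0 : ℝ) • w))).differentiableAt.hasFDerivAt.restrictScalars ℝ).comp_hasDerivAt 0 hc
  simpa [slice, Function.comp_def] using hd

theorem coef_slice_iterate (hf : IsPeriodicHolo r f) {y : Fin d → ℝ} (hy : ∀ i, |y i| < r)
    (j : Fin d) (k : Fin d → ℤ) (m : ℕ) :
    IsPeriodicHolo r ((fun g θ => fderiv ℂ g θ (Pi.single j 1))^[m] f) ∧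
    coef (slice ((fun g θ => fderiv ℂ g θ (Pi.single j 1))^[m] f) y) k =
      (Complex.I * k j) ^ m * coef (slice f y) k := by
  induction m with
  | zero => simpa using hf
  | succ m ih =>
    simp only [Function.iterate_succ_apply']
    refine ⟨ih.1.fderiv_apply _, ?_⟩
    have := ih.1.coef_slice_fderiv hy (Pi.single j 1) k
    rw [toComplex_single, ih.2] at this
    rw [this, Finset.sum_eq_single j (fun b _ hb => by simp [hb]) (by simp)]
    simp
    ring

/-- On every slice of constant imaginary part, the operator `D · ω + c` multiplies the `k`-th
Fourier coefficient by `c + i k·ω`. -/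
theorem coef_slice_of_fderiv_add {g : (Fin d → ℂ) → ℂ} {ω : Fin d → ℝ} {c : ℂ}
    (hf : IsPeriodicHolo r f)
    (hfg : ∀ θ ∈ strip d r, fderiv ℂ f θ (toComplex ω) + c * f θ = g θ)
    {y : Fin d → ℝ} (hy : ∀ i, |y i| < r) (k : Fin d → ℤ) :
    (c + Complex.I * ∑ i, (k i : ℂ) * (ω i : ℂ)) * coef (slice f y) k = coef (slice g y) k := by
  have h1 : slice g y = fun x => slice (fun θ => fderiv ℂ f θ (toComplex ω)) y x +
      c * slice f y x := funext fun x => (hfg _ (slice_mem_strip hy x)).symm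
  have h2 : IsContPeriodic fun x => c * slice f y x :=
    (hf.const_mul c).isContPeriodic_slice hy
  rw [h1, coef_add ((hf.fderiv_apply _).isContPeriodic_slice hy) h2, coef_const_mul,
    hf.coef_slice_fderiv hy]
  ring

end IsPeriodicHolo

/-- `ℤ^d` is a lattice of rank `d` in `ℝ^d`; the power sum over a lattice converges below minus its
rank. -/
theorem summable_norm_rpow_int {p : ℝ} (hp : p < -d) :
    Summable fun k : Fin d → ℤ => ‖k‖ ^ p := by
  let L : Submodule ℤ (Fin d → ℝ) := Submodule.span ℤ (Set.range (Pi.basisFun ℝ (Fin d)))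
  have hmem : ∀ k : Fin d → ℤ, (fun i => (k i : ℝ)) ∈ L := by
    intro k
    have : (fun i => (k i : ℝ)) = ∑ i, k i • Pi.basisFun ℝ (Fin d) i := by
      ext i
      simp [Finset.sum_apply, Pi.single_apply]
    rw [this]
    exact Submodule.sum_mem _ fun i _ =>
      Submodule.smul_mem _ _ (Submodule.subset_span (Set.mem_range_self i))
  have hrank : Module.finrank ℤ L = d := by
    rw [ZLattice.rank ℝ L]; simp
  have hs := ZLattice.summable_norm_rpow L p (by rw [hrank]; exact hp)
  have hinj : Function.Injective fun k : Fin d → ℤ => (⟨fun i => (k i : ℝ), hmem k⟩ : L) := by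
    intro k k' h
    ext i
    have : (k i : ℝ) = k' i := congrFun (congrArg Subtype.val h) i
    exact_mod_cast this
  refine (hs.comp_injective hinj).congr fun k => ?_
  simp only [Function.comp_apply, Submodule.coe_norm]
  congr 1

/-- Rüssmann-type estimate in a crude form. The mean is controlled separately through `c₀`, so that
`C` depends neither on `u` nor on `c`. Reality of `u` is not asked for, since the lemma is applied
to complex combinations of columns. -/
theorem exists_norm_le_of_small_divisors (ω : Fin d → ℝ) {γ τ : ℝ} (hγ : 0 < γ)
    (hτ : (d : ℝ) - 1 < τ) {r r' : ℝ} (hr : r' < r) :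
    ∃ C : ℝ, 0 ≤ C ∧ ∀ (u : (Fin d → ℂ) → ℂ) (c : ℂ) (c₀ V : ℝ),
      IsPeriodicHolo r u →
      (∀ θ ∈ strip d r, ‖fderiv ℂ u θ (toComplex ω) + c * u θ‖ ≤ V) →
      (∀ k : Fin d → ℤ, k ≠ 0 → γ / (∑ l, |(k l : ℝ)|) ^ τ ≤
        ‖c + Complex.I * ∑ i, (k i : ℂ) * (ω i : ℂ)‖) →
      (∀ y : Fin d → ℝ, (∀ i, |y i| < r) → ‖coef (slice u y) 0‖ ≤ c₀ * V) →
      ∀ θ ∈ strip d r', ‖u θ‖ ≤ (c₀ + C) * V := by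
  -- The divisors lose `‖k‖ ^ τ` and `m` derivatives gain `‖k‖ ^ (-m)`; the choice of `m` makes `‖k‖
  -- ^ (τ - m)` summable.
  obtain ⟨m, hm⟩ := exists_nat_gt (τ + d)
  obtain ⟨Cm, hCm0, hCm⟩ := exists_norm_iterate_partialDeriv_le (d := d) m hr
  have hsum : Summable fun k : Fin d → ℤ => ‖k‖ ^ (τ - m) :=
    summable_norm_rpow_int (by linarith)
  refine ⟨Cm * (d : ℝ) ^ τ / γ * ∑' k : Fin d → ℤ, ‖k‖ ^ (τ - m),
    mul_nonneg (by positivity) (tsum_nonneg fun k => by positivity), ?_⟩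
  intro u c c₀ V hu hV hdiv h0 θ hθ
  set v : (Fin d → ℂ) → ℂ := fun θ => fderiv ℂ u θ (toComplex ω) + c * u θ with hv_def
  have hv : IsPeriodicHolo r v := (hu.fderiv_apply _).add (hu.const_mul c)
  have hV0 : 0 ≤ V := (norm_nonneg _).trans (hV θ (strip_mono hr.le hθ))
  -- Expanding on the slice through `θ` itself avoids any shift of contours: the value at `θ` is a
  -- value of the slice.
  set y : Fin d → ℝ := fun i => (θ i).im with hy_def
  have hy' : ∀ i, |y i| < r' := hθ
  have hy : ∀ i, |y i| < r := fun i => (hθ i).trans hr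
  have hcoef := fun k => hu.coef_slice_of_fderiv_add (g := v) (fun _ _ => rfl) hy k
  set b : (Fin d → ℤ) → ℝ := fun k => (if k = 0 then c₀ * V else 0) +
    Cm * V * (d : ℝ) ^ τ / γ * ‖k‖ ^ (τ - m) with hb_def
  have hbound : ∀ k, ‖coef (slice u y) k‖ ≤ b k := by
    intro k
    by_cases hk : k = 0
    · subst hk
      have h1 : 0 ≤ Cm * V * (d : ℝ) ^ τ / γ * ‖(0 : Fin d → ℤ)‖ ^ (τ - m) := by positivity
      have h2 := h0 y hy
      simp only [hb_def, if_true]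
      linarith
    · have hkn : 0 < ‖k‖ := norm_pos_iff.2 hk
      obtain ⟨j0, hj0⟩ := Function.ne_iff.1 hk
      have : Nonempty (Fin d) := ⟨j0⟩
      -- Differentiating in the direction of the largest `|k_j|` gains the full sup norm of `k`.
      obtain ⟨j, hj⟩ := Finite.exists_max fun i => ‖k i‖
      have hkj : ‖k‖ = ‖k j‖ := le_antisymm
        ((pi_norm_le_iff_of_nonneg (norm_nonneg _)).2 hj) (norm_le_pi_norm k j)
      have hd1 : (1 : ℝ) ≤ d := by exact_mod_cast Fin.pos j0
      -- A nonzero `k` forces `d ≥ 1`, hence `τ > 0`, which the monotonicity of `x ^ τ` requires;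
      -- for `d = 0` a negative `τ` is allowed.
      have hτ0 : 0 < τ := by linarith
      have hv1 : ‖k‖ ^ m * ‖coef (slice v y) k‖ ≤ Cm * V := by
        have h1 := norm_coef_le (k := k) (g := slice ((fun g θ =>
          fderiv ℂ g θ (Pi.single j 1))^[m] v) y)
          fun x => (hCm j v V hv hV).2 _ (slice_mem_strip hy' x)
        rw [(hv.coef_slice_iterate hy j k m).2, norm_mul, norm_pow, norm_mul, Complex.norm_I,
          one_mul] at h1
        have h2 : ‖((k j : ℤ) : ℂ)‖ = ‖k‖ := by rw [hkj]; simp [Int.norm_eq_abs]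
        rwa [h2] at h1
      have hS : ∑ l, |(k l : ℝ)| ≤ d * ‖k‖ := by
        calc ∑ l, |(k l : ℝ)| ≤ ∑ _l : Fin d, ‖k‖ := Finset.sum_le_sum fun l _ => by
              simpa [Int.norm_eq_abs] using norm_le_pi_norm k l
          _ = d * ‖k‖ := by simp
      have hS0 : 0 < ∑ l, |(k l : ℝ)| := Finset.sum_pos' (fun _ _ => abs_nonneg _)
        ⟨j0, Finset.mem_univ _, abs_pos.2 (by exact_mod_cast hj0)⟩
      have h3 := congrArg norm (hcoef k)
      rw [norm_mul] at h3
      have h4 : γ / (∑ l, |(k l : ℝ)|) ^ τ * ‖coef (slice u y) k‖ ≤ ‖coef (slice v y) k‖ := by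
        rw [← h3]
        exact mul_le_mul_of_nonneg_right (hdiv k hk) (norm_nonneg _)
      have h5 : ‖coef (slice u y) k‖ ≤ (∑ l, |(k l : ℝ)|) ^ τ / γ * ‖coef (slice v y) k‖ := by
        have : 0 < (∑ l, |(k l : ℝ)|) ^ τ := Real.rpow_pos_of_pos hS0 _
        calc ‖coef (slice u y) k‖ = (∑ l, |(k l : ℝ)|) ^ τ / γ *
              (γ / (∑ l, |(k l : ℝ)|) ^ τ * ‖coef (slice u y) k‖) := by field_simp
          _ ≤ _ := by gcongr
      have h6 : ‖coef (slice v y) k‖ ≤ Cm * V * ‖k‖ ^ (-(m : ℝ)) := by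
        rw [Real.rpow_neg hkn.le, Real.rpow_natCast, ← div_eq_mul_inv, le_div_iff₀ (by positivity)]
        linarith
      simp only [hb_def, hk, if_false, zero_add]
      calc ‖coef (slice u y) k‖ ≤ (∑ l, |(k l : ℝ)|) ^ τ / γ * ‖coef (slice v y) k‖ := h5
        _ ≤ ((d : ℝ) * ‖k‖) ^ τ / γ * (Cm * V * ‖k‖ ^ (-(m : ℝ))) := by gcongr
        _ = Cm * V * (d : ℝ) ^ τ / γ * ‖k‖ ^ (τ - m) := by
          rw [Real.mul_rpow (by positivity) hkn.le, sub_eq_add_neg, Real.rpow_add hkn]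
          ring
  have hb1 : HasSum (fun k : Fin d → ℤ => if k = 0 then c₀ * V else 0) (c₀ * V) :=
    hasSum_ite_eq 0 _
  have hb2 := hb1.add (hsum.hasSum.mul_left (Cm * V * (d : ℝ) ^ τ / γ))
  have hfin := norm_le_tsum_of_norm_coef_le (hu.isContPeriodic_slice hy) hb2.summable hbound
    fun i => (θ i).re
  rw [hb2.tsum_eq] at hfin
  have hθeq : slice u y (fun i => (θ i).re) = u θ := by
    unfold slice
    congr 1
    ext i
    simp [toComplex, hy_def]
  rw [hθeq] at hfin
  refine hfin.trans (le_of_eq ?_)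
  ring

end EllipticTori

namespace EllipticTori

/-! ## Derivatives of matrix-valued maps -/

section MatDeriv

variable {k l : ℕ} {ι κ μ : Type}

theorem fderiv_fderiv_comm {f : (Fin k → ℂ) → ℂ} {z : Fin k → ℂ} (hf : AnalyticAt ℂ f z)
    (u v : Fin k → ℂ) :
    fderiv ℂ (fun w => fderiv ℂ f w u) z v = fderiv ℂ (fun w => fderiv ℂ f w v) z u := by
  have hsymm : IsSymmSndFDerivAt ℂ f z :=
    (hf.contDiffAt (n := ⊤)).isSymmSndFDerivAt (by simp)
  have hd : DifferentiableAt ℂ (fderiv ℂ f) z := hf.fderiv.differentiableAt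
  have h : ∀ u v, fderiv ℂ (fun w => fderiv ℂ f w u) z v = fderiv ℂ (fderiv ℂ f) z v u := by
    intro u v
    rw [fderiv_clm_apply hd (differentiableAt_const u)]
    simp
  rw [h, h, hsymm v u]

theorem clm_apply_eq_sum (T : (Fin k → ℂ) →L[ℂ] ℂ) (v : Fin k → ℂ) :
    T v = ∑ j, v j * T (Pi.single j 1) := by
  conv_lhs => rw [pi_eq_sum_univ' v]
  simp [map_sum]

theorem fderiv_sum_mul [Fintype κ] {f g : κ → (Fin k → ℂ) → ℂ} {z : Fin k → ℂ}
    (hf : ∀ i, DifferentiableAt ℂ (f i) z) (hg : ∀ i, DifferentiableAt ℂ (g i) z)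
    (v : Fin k → ℂ) : fderiv ℂ (fun w => ∑ i, f i w * g i w) z v =
      ∑ i, (f i z * fderiv ℂ (g i) z v + g i z * fderiv ℂ (f i) z v) := by
  rw [fderiv_fun_sum fun i _ => (hf i).fun_mul (hg i), sum_apply]
  refine Finset.sum_congr rfl fun i _ => ?_
  rw [fderiv_fun_mul (hf i) (hg i)]
  simp

/-- The entrywise derivative of a matrix-valued map in the direction `v`. -/
def matDeriv (F : (Fin k → ℂ) → Matrix ι κ ℂ) (z v : Fin k → ℂ) : Matrix ι κ ℂ :=
  Matrix.of fun i j => fderiv ℂ (fun w => F w i j) z v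

/-- The derivative of a vector-valued map in the direction `v`. -/
def vecDeriv (u : (Fin k → ℂ) → ι → ℂ) (z v : Fin k → ℂ) : ι → ℂ :=
  fun i => fderiv ℂ (fun w => u w i) z v

theorem matDeriv_mul [Fintype κ] {F : (Fin k → ℂ) → Matrix ι κ ℂ}
    {G : (Fin k → ℂ) → Matrix κ μ ℂ} {z : Fin k → ℂ}
    (hF : ∀ i j, DifferentiableAt ℂ (fun w => F w i j) z)
    (hG : ∀ i j, DifferentiableAt ℂ (fun w => G w i j) z) (v : Fin k → ℂ) :
    matDeriv (fun w => F w * G w) z v = matDeriv F z v * G z + F z * matDeriv G z v := by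
  ext i j
  simp only [matDeriv, Matrix.of_apply, Matrix.add_apply, Matrix.mul_apply]
  rw [fderiv_sum_mul (f := fun l w => F w i l) (g := fun l w => G w l j) (hF i)
    (fun l => hG l j), ← Finset.sum_add_distrib]
  exact Finset.sum_congr rfl fun l _ => by ring

theorem fderiv_comp_pi {F : (Fin l → ℂ) → ℂ} {u : (Fin k → ℂ) → Fin l → ℂ} {z : Fin k → ℂ}
    (hF : DifferentiableAt ℂ F (u z)) (hu : ∀ i, DifferentiableAt ℂ (fun w => u w i) z)
    (v : Fin k → ℂ) : fderiv ℂ (fun w => F (u w)) z v = fderiv ℂ F (u z) (vecDeriv u z v) := by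
  have hu' : HasFDerivAt u (ContinuousLinearMap.pi fun i => fderiv ℂ (fun w => u w i) z) z :=
    hasFDerivAt_pi.2 fun i => (hu i).hasFDerivAt
  have := (hF.hasFDerivAt.comp z hu').fderiv
  simp only [Function.comp_def] at this
  rw [this]
  rfl

theorem matDeriv_comp {F : (Fin l → ℂ) → Matrix ι κ ℂ} {u : (Fin k → ℂ) → Fin l → ℂ}
    {z : Fin k → ℂ} (hF : ∀ i j, DifferentiableAt ℂ (fun w => F w i j) (u z))
    (hu : ∀ i, DifferentiableAt ℂ (fun w => u w i) z) (v : Fin k → ℂ) :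
    matDeriv (fun w => F (u w)) z v = matDeriv F (u z) (vecDeriv u z v) := by
  ext i j
  exact fderiv_comp_pi (hF i j) hu v

theorem matDeriv_sub_right (F : (Fin k → ℂ) → Matrix ι κ ℂ) (z v w : Fin k → ℂ) :
    matDeriv F z (v - w) = matDeriv F z v - matDeriv F z w := by
  ext i j
  simp [matDeriv]

end MatDeriv

/-! ## The symplectic form is invariant under Hamiltonian flows -/

namespace CompatibleTriple

variable {n : ℕ} (S : CompatibleTriple n)

theorem Ω_apply (z : Fin (2 * n) → ℂ) (i j : Fin (2 * n)) :
    S.Ω z i j = fderiv ℂ (fun w => S.a w j) z (Pi.single i 1) -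
      fderiv ℂ (fun w => S.a w i) z (Pi.single j 1) := rfl

theorem Ω_transpose (z : Fin (2 * n) → ℂ) : (S.Ω z)ᵀ = -S.Ω z := by
  ext i j
  simp [Ω_apply]

theorem matHolo_Ω : MatHolo S.domain S.Ω := fun i j =>
  ((S.a_holo j).partialDeriv S.isOpen_domain i).sub ((S.a_holo i).partialDeriv S.isOpen_domain j)

theorem hamVF_holo {h : (Fin (2 * n) → ℂ) → ℂ} (hh : IsRealHolomorphicOn S.domain h)
    (i : Fin (2 * n)) : IsRealHolomorphicOn S.domain fun z => S.hamVF h z i := by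
  simp only [hamVF, Matrix.mulVec, dotProduct]
  exact .sum _ fun j _ =>
    (S.matHolo_Ω.inv S.nondegenerate i j).mul (hh.partialDeriv S.isOpen_domain j)

theorem sum_Ω_mul_hamVF (h : (Fin (2 * n) → ℂ) → ℂ) {z : Fin (2 * n) → ℂ} (hz : z ∈ S.domain)
    (i : Fin (2 * n)) : ∑ l, S.Ω z i l * S.hamVF h z l = fderiv ℂ h z (Pi.single i 1) := by
  have h1 : S.Ω z *ᵥ S.hamVF h z = fun j => fderiv ℂ h z (Pi.single j 1) := by
    have h2 : S.Ω z * (S.Ω z)⁻¹ = 1 := Matrix.mul_nonsing_inv _ (S.nondegenerate z hz).isUnit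
    unfold hamVF
    rw [Matrix.mulVec_mulVec, h2, Matrix.one_mulVec]
  exact congrFun h1 i

/-- The two-form is closed. -/
theorem fderiv_Ω_cyclic {z : Fin (2 * n) → ℂ} (hz : z ∈ S.domain) (i j l : Fin (2 * n)) :
    fderiv ℂ (fun w => S.Ω w j l) z (Pi.single i 1) +
      fderiv ℂ (fun w => S.Ω w l i) z (Pi.single j 1) +
      fderiv ℂ (fun w => S.Ω w i j) z (Pi.single l 1) = 0 := by
  have hd : ∀ p q, DifferentiableAt ℂ (fun w => fderiv ℂ (fun w => S.a w p) w (Pi.single q 1)) z :=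
    fun p q => ((S.a_holo p).partialDeriv S.isOpen_domain q).differentiableAt hz
  simp only [Ω_apply]
  rw [fderiv_fun_sub (hd _ _) (hd _ _), fderiv_fun_sub (hd _ _) (hd _ _),
    fderiv_fun_sub (hd _ _) (hd _ _)]
  simp only [sub_apply]
  -- The six second derivatives of `a` cancel in pairs once mixed partials are interchanged.
  rw [fderiv_fderiv_comm ((S.a_holo l).analytic z hz) (Pi.single j 1),
    fderiv_fderiv_comm ((S.a_holo j).analytic z hz) (Pi.single l 1),
    fderiv_fderiv_comm ((S.a_holo i).analytic z hz) (Pi.single l 1)]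
  ring

/-- The Lie derivative of the two-form along a Hamiltonian vector field vanishes. -/
theorem lie_Ω {h : (Fin (2 * n) → ℂ) → ℂ} (hh : IsRealHolomorphicOn S.domain h)
    {z : Fin (2 * n) → ℂ} (hz : z ∈ S.domain) :
    (jac (S.hamVF h) z)ᵀ * S.Ω z + matDeriv S.Ω z (S.hamVF h z) + S.Ω z * jac (S.hamVF h) z
      = 0 := by
  have hΩ : ∀ i j, DifferentiableAt ℂ (fun w => S.Ω w i j) z :=
    fun i j => (S.matHolo_Ω i j).differentiableAt hz
  have hX : ∀ i, DifferentiableAt ℂ (fun w => S.hamVF h w i) z :=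
    fun i => (S.hamVF_holo hh i).differentiableAt hz
  have hΩX : ∀ i j : Fin (2 * n), fderiv ℂ (fun w => fderiv ℂ h w (Pi.single i 1)) z
      (Pi.single j 1) = ∑ l, (S.Ω z i l * fderiv ℂ (fun w => S.hamVF h w l) z (Pi.single j 1) +
        S.hamVF h z l * fderiv ℂ (fun w => S.Ω w i l) z (Pi.single j 1)) := by
    intro i j
    have h1 : (fun w => fderiv ℂ h w (Pi.single i 1)) =ᶠ[nhds z]
        fun w => ∑ l, S.Ω w i l * S.hamVF h w l := by
      filter_upwards [S.isOpen_domain.mem_nhds hz] with w hw using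
        (S.sum_Ω_mul_hamVF h hw i).symm
    rw [h1.fderiv_eq]
    exact fderiv_sum_mul (f := fun l w => S.Ω w i l) (g := fun l w => S.hamVF h w l) (hΩ i) hX _
  have hanti : ∀ i j : Fin (2 * n), (fun w => S.Ω w j i) = fun w => -S.Ω w i j := fun i j =>
    funext fun w => by simp [Ω_apply]
  ext i j
  -- Symmetry of the Hessian of `h`, read through `Ω X_h = (D h)ᵀ`, says that the contraction of the
  -- two-form with `X_h` is closed. With closedness of the form itself this is Cartan's formula in
  -- coordinates.
  have hsymm := fderiv_fderiv_comm (hh.analytic z hz) (Pi.single i 1) (Pi.single j 1)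
  rw [hΩX, hΩX] at hsymm
  simp only [Matrix.add_apply, Matrix.mul_apply, Matrix.transpose_apply, jac, Matrix.of_apply,
    matDeriv, Matrix.zero_apply]
  rw [clm_apply_eq_sum, ← Finset.sum_add_distrib, ← Finset.sum_add_distrib]
  rw [← sub_eq_zero, ← Finset.sum_sub_distrib] at hsymm
  rw [← hsymm]
  refine Finset.sum_congr rfl fun l _ => ?_
  have hc := S.fderiv_Ω_cyclic hz i j l
  have h2 : S.Ω z l j = -S.Ω z j l := congrFun (hanti j l) z
  have h3 : fderiv ℂ (fun w => S.Ω w l i) z (Pi.single j 1) =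
      -fderiv ℂ (fun w => S.Ω w i l) z (Pi.single j 1) := by
    rw [hanti i l, fderiv_fun_neg]; rfl
  rw [h3] at hc
  rw [h2]
  linear_combination (S.hamVF h z l) * hc

end CompatibleTriple

/-! ## Propagation of the invariance errors -/

section Propagation

variable {n d : ℕ} {S : CompatibleTriple n} {h : (Fin (2 * n) → ℂ) → ℂ} {ω : Fin d → ℝ}
  {K : (Fin d → ℂ) → Fin (2 * n) → ℂ} {ρ : ℝ}

theorem vecDeriv_K (θ : Fin d → ℂ) :
    vecDeriv K θ (toComplex ω) = S.hamVF h (K θ) - errK S h ω K θ := by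
  ext i
  simp [vecDeriv, errK, lieDeriv]

theorem errK_holo (hh : IsRealHolomorphicOn S.domain h)
    (hK : ∀ i, IsRealHolomorphicOn (strip d ρ) fun θ => K θ i)
    (hKS : ∀ θ ∈ strip d ρ, K θ ∈ S.domain) (i : Fin (2 * n)) :
    IsRealHolomorphicOn (strip d ρ) fun θ => errK S h ω K θ i :=
  ((hK i).fderiv_apply (isOpen_strip d ρ) ω).neg.add ((S.hamVF_holo hh i).comp hK hKS)

/-- Differentiate `D K · ω = X_h ∘ K - E_K` in `θ` and interchange the derivatives: tangent vectors
solve the linearised equation up to `D E_K`. -/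
theorem matDeriv_frameL (hh : IsRealHolomorphicOn S.domain h)
    (hK : ∀ i, IsRealHolomorphicOn (strip d ρ) fun θ => K θ i)
    (hKS : ∀ θ ∈ strip d ρ, K θ ∈ S.domain) {θ : Fin d → ℂ} (hθ : θ ∈ strip d ρ) :
    matDeriv (frameL K) θ (toComplex ω) =
      jac (S.hamVF h) (K θ) * frameL K θ - jac (errK S h ω K) θ := by
  ext i j
  simp only [matDeriv, frameL, jac, Matrix.of_apply, Matrix.sub_apply, Matrix.mul_apply]
  rw [fderiv_fderiv_comm ((hK i).analytic θ hθ)]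
  have h1 : (fun w => fderiv ℂ (fun φ => K φ i) w (toComplex ω)) =
      fun w => S.hamVF h (K w) i - errK S h ω K w i := funext fun w => by
    simpa [vecDeriv] using congrFun (vecDeriv_K (S := S) (h := h) (ω := ω) (K := K) w) i
  rw [h1, fderiv_fun_sub (((S.hamVF_holo hh i).comp hK hKS).differentiableAt hθ)
    ((errK_holo hh hK hKS i).differentiableAt hθ), sub_apply,
    fderiv_comp_pi (F := fun z => S.hamVF h z i)
      ((S.hamVF_holo hh i).differentiableAt (hKS θ hθ)) fun i => (hK i).differentiableAt hθ,
    clm_apply_eq_sum]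
  simp only [vecDeriv, mul_comm]

theorem matDeriv_W {α β : Fin (n - d) → ℝ} {W : MatMap n d (NormalIdx n d)} (θ : Fin d → ℂ) :
    matDeriv W θ (toComplex ω) = jac (S.hamVF h) (K θ) * W θ -
      (W θ * Gam α β + errW S h ω α β K W θ) := by
  ext i j
  simp [matDeriv, errW, lieDeriv]

/-- `K` moves along `X_h` up to `E_K`, so by the product rule the terms with `D X_h` combine with
the derivative of `Ω` along `X_h` and vanish by `lie_Ω`. What is left is linear in `R₁`, `R₂` and
`E_K`. -/
theorem matDeriv_pairΩ (hh : IsRealHolomorphicOn S.domain h)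
    (hK : ∀ i, IsRealHolomorphicOn (strip d ρ) fun θ => K θ i)
    (hKS : ∀ θ ∈ strip d ρ, K θ ∈ S.domain) {κ₁ κ₂ : Type} {V₁ : MatMap n d κ₁}
    {V₂ : MatMap n d κ₂} (hV₁ : MatHolo (strip d ρ) V₁) (hV₂ : MatHolo (strip d ρ) V₂)
    {θ : Fin d → ℂ} (hθ : θ ∈ strip d ρ) {R₁ : Matrix (Fin (2 * n)) κ₁ ℂ}
    {R₂ : Matrix (Fin (2 * n)) κ₂ ℂ}
    (h₁ : matDeriv V₁ θ (toComplex ω) = jac (S.hamVF h) (K θ) * V₁ θ - R₁)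
    (h₂ : matDeriv V₂ θ (toComplex ω) = jac (S.hamVF h) (K θ) * V₂ θ - R₂) :
    matDeriv (pairΩ S K V₁ V₂) θ (toComplex ω) =
      -(R₁ᵀ * S.Ω (K θ) * V₂ θ) - (V₁ θ)ᵀ * S.Ω (K θ) * R₂ -
        (V₁ θ)ᵀ * matDeriv S.Ω (K θ) (errK S h ω K θ) * V₂ θ := by
  have hΩ : MatHolo (strip d ρ) fun θ => S.Ω (K θ) := S.matHolo_Ω.comp hK hKS
  have hT : matDeriv (fun θ => (V₁ θ)ᵀ) θ (toComplex ω) =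
      (matDeriv V₁ θ (toComplex ω))ᵀ := rfl
  have hlie := S.lie_Ω hh (hKS θ hθ)
  have e1 : matDeriv (pairΩ S K V₁ V₂) θ (toComplex ω) = _ :=
    matDeriv_mul (F := fun θ => (V₁ θ)ᵀ * S.Ω (K θ)) (G := V₂)
    (fun i j => (hV₁.transpose.mul hΩ i j).differentiableAt hθ)
    (fun i j => (hV₂ i j).differentiableAt hθ) (toComplex ω)
  rw [e1, matDeriv_mul (fun i j => (hV₁.transpose i j).differentiableAt hθ)
    (fun i j => (hΩ i j).differentiableAt hθ), hT,
    matDeriv_comp (fun i j => (S.matHolo_Ω i j).differentiableAt (hKS θ hθ))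
      (fun i => (hK i).differentiableAt hθ), vecDeriv_K (S := S) (h := h), matDeriv_sub_right,
    h₁, h₂]
  have h3 : matDeriv S.Ω (K θ) (S.hamVF h (K θ)) =
      -((jac (S.hamVF h) (K θ))ᵀ * S.Ω (K θ)) - S.Ω (K θ) * jac (S.hamVF h) (K θ) := by
    rw [← sub_eq_zero, ← hlie]; abel
  rw [h3]
  simp only [Matrix.transpose_sub, Matrix.transpose_mul, Matrix.sub_mul, Matrix.mul_sub,
    Matrix.add_mul, Matrix.mul_neg, Matrix.neg_mul, Matrix.mul_assoc]
  abel

/-- The pull-back of the two-form by `K` is exact. -/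
theorem pairΩ_frameL_eq (hK : ∀ i, IsRealHolomorphicOn (strip d ρ) fun θ => K θ i)
    (hKS : ∀ θ ∈ strip d ρ, K θ ∈ S.domain) {θ : Fin d → ℂ} (hθ : θ ∈ strip d ρ) (i j : Fin d) :
    pairΩ S K (frameL K) (frameL K) θ i j =
      fderiv ℂ (fun φ => ∑ m, S.a (K φ) m * frameL K φ m j) θ (Pi.single i 1) -
      fderiv ℂ (fun φ => ∑ m, S.a (K φ) m * frameL K φ m i) θ (Pi.single j 1) := by
  have hL : MatHolo (strip d ρ) (frameL K) := matHolo_jac (isOpen_strip d ρ) hK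
  have key : ∀ i j : Fin d,
      fderiv ℂ (fun φ => ∑ m, S.a (K φ) m * frameL K φ m j) θ (Pi.single i 1) =
      ∑ m, (S.a (K θ) m * fderiv ℂ (fun φ => frameL K φ m j) θ (Pi.single i 1) +
        frameL K θ m j * ∑ l, frameL K θ l i * jac S.a (K θ) m l) := by
    intro i j
    have ha : ∀ m, DifferentiableAt ℂ (fun φ => S.a (K φ) m) θ :=
      fun m => ((S.a_holo m).comp hK hKS).differentiableAt hθ
    have hLd : ∀ m, DifferentiableAt ℂ (fun φ => frameL K φ m j) θ :=
      fun m => (hL m j).differentiableAt hθ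
    rw [fderiv_sum_mul (f := fun m φ => S.a (K φ) m) (g := fun m φ => frameL K φ m j) ha hLd]
    refine Finset.sum_congr rfl fun m _ => ?_
    rw [fderiv_comp_pi (F := fun z => S.a z m) ((S.a_holo m).differentiableAt (hKS θ hθ))
      fun i => (hK i).differentiableAt hθ,
      clm_apply_eq_sum (fderiv ℂ (fun z => S.a z m) (K θ))]
    rfl
  have hsymm : ∀ m, fderiv ℂ (fun φ => frameL K φ m j) θ (Pi.single i 1) =
      fderiv ℂ (fun φ => frameL K φ m i) θ (Pi.single j 1) := fun m =>
    fderiv_fderiv_comm ((hK m).analytic θ hθ) _ _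
  rw [key, key]
  simp only [hsymm, Finset.sum_add_distrib, add_sub_add_left_eq_sub, pairΩ, Matrix.mul_apply,
    CompatibleTriple.Ω, twoForm, Matrix.transpose_apply, Matrix.sub_apply, mul_sub, sub_mul,
    Finset.sum_sub_distrib, Finset.sum_mul, Finset.mul_sum]
  congr 1
  · exact Finset.sum_congr rfl fun _ _ => Finset.sum_congr rfl fun _ _ => by ring
  · rw [Finset.sum_comm]
    exact Finset.sum_congr rfl fun _ _ => Finset.sum_congr rfl fun _ _ => by ring

end Propagation

end EllipticTori

namespace EllipticTori

/-! ## Block algebra of the adapted frame -/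

section Blocks

variable {ι κ μ : Type} [Fintype ι] [DecidableEq ι] [Fintype κ] [DecidableEq κ]
  [Fintype μ] {Ω G J : Matrix ι ι ℂ} {L N : Matrix ι κ ℂ} {W : Matrix ι μ ℂ}
  {A B : Matrix κ κ ℂ} {C : Matrix μ κ ℂ}

/-- The relations between the matrices that enter the adapted frame at one point. -/
structure IsAdaptedFrame (Ω G J : Matrix ι ι ℂ) (L N : Matrix ι κ ℂ) (W : Matrix ι μ ℂ)
    (A B : Matrix κ κ ℂ) (C : Matrix μ κ ℂ) : Prop where
  Ω_transpose : Ωᵀ = -Ω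
  G_transpose : Gᵀ = G
  J_sq : J * J = -1
  compatible : Jᵀ * Ω = G
  B_inv : (Lᵀ * G * L) * B = 1
  C_eq : (Wᵀ * Ω * W) * C = Wᵀ * G * L * B
  A_eq : A = (1 / 2 : ℂ) • (Cᵀ * (Wᵀ * Ω * W) * C)
  N_eq : N = L * A + J * L * B + W * C

namespace IsAdaptedFrame

theorem Ω_mul_J (hF : IsAdaptedFrame Ω G J L N W A B C) :
    Ω * J = -G := by
  have h := congrArg Matrix.transpose hF.compatible
  rw [Matrix.transpose_mul, hF.Ω_transpose, hF.G_transpose, Matrix.transpose_transpose,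
    Matrix.neg_mul] at h
  rw [← h, neg_neg]

theorem G_mul_J (hF : IsAdaptedFrame Ω G J L N W A B C) :
    G * J = Ω := by
  have h : G = -(Ω * J) := by rw [hF.Ω_mul_J, neg_neg]
  rw [h, Matrix.neg_mul, Matrix.mul_assoc, hF.J_sq]
  simp

theorem B_transpose_mul (hF : IsAdaptedFrame Ω G J L N W A B C) :
    Bᵀ * (Lᵀ * G * L) = 1 := by
  have h := congrArg Matrix.transpose hF.B_inv
  simpa [Matrix.transpose_mul, hF.G_transpose, Matrix.mul_assoc] using h

theorem C_transpose_mul (hF : IsAdaptedFrame Ω G J L N W A B C) :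
    Cᵀ * (Wᵀ * Ω * W) = -(Bᵀ * (Lᵀ * G * W)) := by
  have h := congrArg Matrix.transpose hF.C_eq
  simp only [Matrix.transpose_mul, hF.G_transpose, hF.Ω_transpose, Matrix.transpose_transpose,
    Matrix.neg_mul, Matrix.mul_neg, Matrix.mul_assoc] at h ⊢
  rw [← h, neg_neg]

theorem W_Ω_L (hF : IsAdaptedFrame Ω G J L N W A B C) :
    Wᵀ * Ω * L = -(Lᵀ * Ω * W)ᵀ := by
  simp [Matrix.transpose_mul, hF.Ω_transpose, Matrix.mul_assoc]

theorem A_sub_transpose (hF : IsAdaptedFrame Ω G J L N W A B C) :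
    A - Aᵀ = Cᵀ * (Wᵀ * Ω * W) * C := by
  have h : (Cᵀ * (Wᵀ * Ω * W) * C)ᵀ = -(Cᵀ * (Wᵀ * Ω * W) * C) := by
    simp [Matrix.transpose_mul, hF.Ω_transpose, Matrix.mul_assoc]
  rw [hF.A_eq, Matrix.transpose_smul, h, smul_neg, sub_neg_eq_add, ← add_smul]
  norm_num

theorem Ω_mul_N (hF : IsAdaptedFrame Ω G J L N W A B C) :
    Ω * N = Ω * L * A - G * L * B + Ω * W * C := by
  rw [hF.N_eq]
  simp only [Matrix.mul_add, ← Matrix.mul_assoc, hF.Ω_mul_J, Matrix.neg_mul]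
  abel

theorem N_transpose_mul_Ω (hF : IsAdaptedFrame Ω G J L N W A B C) :
    Nᵀ * Ω = Aᵀ * Lᵀ * Ω + Bᵀ * Lᵀ * G + Cᵀ * Wᵀ * Ω := by
  rw [hF.N_eq]
  simp only [Matrix.transpose_add, Matrix.transpose_mul, Matrix.add_mul, Matrix.mul_assoc,
    hF.compatible]

/-- `B` provides the identity here, through `Bᵀ G_LL = 1`; the remainder is linear in `X` and `Y`.
-/
theorem N_Ω_L (hF : IsAdaptedFrame Ω G J L N W A B C) :
    Nᵀ * Ω * L = 1 + (Aᵀ * (Lᵀ * Ω * L) - Cᵀ * (Lᵀ * Ω * W)ᵀ) := by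
  have h1 := hF.B_transpose_mul
  have h2 := hF.W_Ω_L
  rw [hF.N_transpose_mul_Ω, ← h1, sub_eq_add_neg, ← Matrix.mul_neg, ← h2]
  simp only [Matrix.add_mul, Matrix.mul_assoc]
  abel

/-- `C` is chosen for this: `Cᵀ Ω_WW` cancels the term `Bᵀ G_LW` produced by `J L B`. -/
theorem N_Ω_W (hF : IsAdaptedFrame Ω G J L N W A B C) :
    Nᵀ * Ω * W = Aᵀ * (Lᵀ * Ω * W) := by
  have h1 := hF.C_transpose_mul
  rw [hF.N_transpose_mul_Ω]
  simp only [Matrix.add_mul, Matrix.mul_assoc] at h1 ⊢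
  rw [h1]
  abel

theorem L_Ω_N (hF : IsAdaptedFrame Ω G J L N W A B C) :
    -Lᵀ * Ω * N = 1 - ((Lᵀ * Ω * L) * A + (Lᵀ * Ω * W) * C) := by
  have h1 := hF.B_inv
  rw [Matrix.mul_assoc, hF.Ω_mul_N, ← h1]
  simp only [Matrix.mul_add, Matrix.mul_sub, Matrix.neg_mul, Matrix.mul_assoc]
  abel

theorem W_Ω_N (hF : IsAdaptedFrame Ω G J L N W A B C) :
    Wᵀ * Ω * N = -((Lᵀ * Ω * W)ᵀ * A) := by
  have h1 := hF.C_eq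
  have h2 := hF.W_Ω_L
  rw [Matrix.mul_assoc, hF.Ω_mul_N, ← Matrix.neg_mul, ← h2]
  simp only [Matrix.mul_add, Matrix.mul_sub, Matrix.mul_assoc] at h1 ⊢
  rw [h1]
  abel

/-- This explains `A`: the part free of `X` and `Y` is `A - Aᵀ - Cᵀ Ω_WW C`. As `Cᵀ Ω_WW C` is
antisymmetric, half of it makes that part zero. -/
theorem N_Ω_N (hF : IsAdaptedFrame Ω G J L N W A B C) :
    Nᵀ * Ω * N = Aᵀ * (Lᵀ * Ω * L) * A + Aᵀ * (Lᵀ * Ω * W) * C +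
    Bᵀ * (Lᵀ * Ω * L) * B - Cᵀ * (Lᵀ * Ω * W)ᵀ * A := by
  have hLN : Lᵀ * Ω * N = (Lᵀ * Ω * L) * A + (Lᵀ * Ω * W) * C - 1 := by
    have h := hF.L_Ω_N
    rw [Matrix.neg_mul, Matrix.neg_mul] at h
    rw [← neg_neg (Lᵀ * Ω * N), h]
    abel
  have hGN : Bᵀ * (Lᵀ * G * N) = A + Bᵀ * (Lᵀ * Ω * L) * B - Cᵀ * (Wᵀ * Ω * W) * C := by
    rw [hF.C_transpose_mul]
    conv_rhs => rw [← Matrix.one_mul A, ← hF.B_transpose_mul]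
    rw [hF.N_eq, ← hF.G_mul_J]
    simp only [Matrix.mul_add, Matrix.neg_mul, Matrix.mul_assoc]
    abel
  calc Nᵀ * Ω * N = Aᵀ * (Lᵀ * Ω * N) + Bᵀ * (Lᵀ * G * N) + Cᵀ * (Wᵀ * Ω * N) := by
        rw [hF.N_transpose_mul_Ω]
        simp only [Matrix.add_mul, Matrix.mul_assoc]
    _ = _ := by
        rw [hLN, hGN, hF.W_Ω_N, ← hF.A_sub_transpose]
        simp only [Matrix.mul_add, Matrix.mul_sub, Matrix.mul_neg, Matrix.mul_one,
          Matrix.mul_assoc]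
        abel

end IsAdaptedFrame

/-- The defect of the approximate inverse, in terms of `X = Lᵀ Ω L`, `Y = Lᵀ Ω W` and
`V = (Wᵀ Ω W)⁻¹`. -/
def frameDefect (A B : Matrix κ κ ℂ) (C : Matrix μ κ ℂ) (X : Matrix κ κ ℂ) (Y : Matrix κ μ ℂ)
    (V : Matrix μ μ ℂ) : Matrix (κ ⊕ (κ ⊕ μ)) (κ ⊕ (κ ⊕ μ)) ℂ :=
  Matrix.fromRows
    (Matrix.fromCols (Aᵀ * X - Cᵀ * Yᵀ)
      (Matrix.fromCols (Aᵀ * X * A + Aᵀ * Y * C + Bᵀ * X * B - Cᵀ * Yᵀ * A) (Aᵀ * Y)))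
    (Matrix.fromRows
      (Matrix.fromCols (-X) (Matrix.fromCols (-(X * A + Y * C)) (-Y)))
      (Matrix.fromCols (-(V * Yᵀ)) (Matrix.fromCols (-(V * (Yᵀ * A))) 0)))

theorem IsAdaptedFrame.approxInv_mul [DecidableEq μ]
    (hF : IsAdaptedFrame Ω G J L N W A B C)
    (hW : (Wᵀ * Ω * W).det ≠ 0) :
    Matrix.fromRows (Nᵀ * Ω) (Matrix.fromRows (-Lᵀ * Ω) ((Wᵀ * Ω * W)⁻¹ * Wᵀ * Ω)) *
      Matrix.fromCols L (Matrix.fromCols N W) =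
    1 + frameDefect A B C (Lᵀ * Ω * L) (Lᵀ * Ω * W) (Wᵀ * Ω * W)⁻¹ := by
  have h7 : (Wᵀ * Ω * W)⁻¹ * Wᵀ * Ω * L = -((Wᵀ * Ω * W)⁻¹ * (Lᵀ * Ω * W)ᵀ) := by
    rw [← Matrix.mul_neg, ← hF.W_Ω_L]
    simp only [Matrix.mul_assoc]
  have h8 : (Wᵀ * Ω * W)⁻¹ * Wᵀ * Ω * N = -((Wᵀ * Ω * W)⁻¹ * ((Lᵀ * Ω * W)ᵀ * A)) := by
    rw [← Matrix.mul_neg, ← hF.W_Ω_N]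
    simp only [Matrix.mul_assoc]
  have h9 : (Wᵀ * Ω * W)⁻¹ * Wᵀ * Ω * W = 1 := by
    rw [Matrix.mul_assoc, Matrix.mul_assoc, ← Matrix.mul_assoc Wᵀ,
      Matrix.nonsing_inv_mul _ hW.isUnit]
  simp only [Matrix.fromRows_mul, Matrix.mul_fromCols, h7, h8, h9, hF.N_Ω_L, hF.N_Ω_N, hF.N_Ω_W,
    hF.L_Ω_N, frameDefect]
  ext (i | i | i) (j | j | j) <;> simp [Matrix.one_apply, Matrix.neg_mul, sub_eq_add_neg]

end Blocks

end EllipticTori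

namespace EllipticTori

/-! ## Uniform bounds for families of matrix-valued maps -/

/-- The entries of the maps `F x`, `x : ι`, are bounded on the strip of width `r` by a constant
multiple of `e x`, with a constant that does not depend on `x`. -/
def UniformBound {ι : Type} {d : ℕ} {κ μ : Type} (e : ι → ℝ) (r : ℝ)
    (F : ι → (Fin d → ℂ) → Matrix κ μ ℂ) : Prop :=
  ∃ C : ℝ, 0 ≤ C ∧ ∀ x, ∀ θ ∈ strip d r, ∀ i j, ‖F x θ i j‖ ≤ C * e x

namespace UniformBound

variable {ι : Type} {d : ℕ} {κ μ ν : Type} {e : ι → ℝ} {r : ℝ}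

theorem mono {r' : ℝ} {F : ι → (Fin d → ℂ) → Matrix κ μ ℂ} (hF : UniformBound e r F)
    (h : r' ≤ r) : UniformBound e r' F := by
  obtain ⟨C, hC, h1⟩ := hF
  exact ⟨C, hC, fun x θ hθ => h1 x θ (strip_mono h hθ)⟩

theorem comp {ι' : Type} (φ : ι' → ι) {F : ι → (Fin d → ℂ) → Matrix κ μ ℂ}
    (hF : UniformBound e r F) : UniformBound (fun x => e (φ x)) r fun x => F (φ x) := by
  obtain ⟨C, hC, h1⟩ := hF
  exact ⟨C, hC, fun x => h1 (φ x)⟩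

theorem add {F G : ι → (Fin d → ℂ) → Matrix κ μ ℂ} (hF : UniformBound e r F)
    (hG : UniformBound e r G) : UniformBound e r fun x θ => F x θ + G x θ := by
  obtain ⟨C, hC, h1⟩ := hF
  obtain ⟨C', hC', h2⟩ := hG
  refine ⟨C + C', add_nonneg hC hC', fun x θ hθ i j => ?_⟩
  rw [add_mul]
  exact (norm_add_le _ _).trans (add_le_add (h1 x θ hθ i j) (h2 x θ hθ i j))

theorem neg {F : ι → (Fin d → ℂ) → Matrix κ μ ℂ} (hF : UniformBound e r F) :
    UniformBound e r fun x θ => -F x θ := by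
  obtain ⟨C, hC, h1⟩ := hF
  exact ⟨C, hC, fun x θ hθ i j => by simpa using h1 x θ hθ i j⟩

theorem sub {F G : ι → (Fin d → ℂ) → Matrix κ μ ℂ} (hF : UniformBound e r F)
    (hG : UniformBound e r G) : UniformBound e r fun x θ => F x θ - G x θ := by
  simpa only [sub_eq_add_neg] using hF.add hG.neg

theorem transpose {F : ι → (Fin d → ℂ) → Matrix κ μ ℂ} (hF : UniformBound e r F) :
    UniformBound e r fun x θ => (F x θ)ᵀ := by
  obtain ⟨C, hC, h1⟩ := hF
  exact ⟨C, hC, fun x θ hθ i j => h1 x θ hθ j i⟩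

theorem smul (c : ℂ) {F : ι → (Fin d → ℂ) → Matrix κ μ ℂ} (hF : UniformBound e r F) :
    UniformBound e r fun x θ => c • F x θ := by
  obtain ⟨C, hC, h1⟩ := hF
  refine ⟨‖c‖ * C, by positivity, fun x θ hθ i j => ?_⟩
  change ‖(c • F x θ) i j‖ ≤ _
  rw [Matrix.smul_apply, norm_smul, mul_assoc]
  exact mul_le_mul_of_nonneg_left (h1 x θ hθ i j) (norm_nonneg c)

theorem mul [Fintype μ] {f : ι → ℝ} {F : ι → (Fin d → ℂ) → Matrix κ μ ℂ}
    {G : ι → (Fin d → ℂ) → Matrix μ ν ℂ} (hF : UniformBound f r F) (hG : UniformBound e r G) :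
    UniformBound (fun x => f x * e x) r fun x θ => F x θ * G x θ := by
  obtain ⟨C, hC, h1⟩ := hF
  obtain ⟨C', hC', h2⟩ := hG
  refine ⟨Fintype.card μ * (C * C'), by positivity, fun x θ hθ i j => ?_⟩
  change ‖(F x θ * G x θ) i j‖ ≤ _
  rw [Matrix.mul_apply]
  calc ‖∑ l, F x θ i l * G x θ l j‖ ≤ ∑ _l : μ, (C * f x) * (C' * e x) := by
        refine norm_sum_le_of_le _ fun l _ => ?_
        rw [norm_mul]
        exact mul_le_mul (h1 x θ hθ i l) (h2 x θ hθ l j) (norm_nonneg _)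
          ((norm_nonneg _).trans (h1 x θ hθ i l))
    _ = Fintype.card μ * (C * C') * (f x * e x) := by simp; ring

theorem bounded_mul [Fintype μ] {F : ι → (Fin d → ℂ) → Matrix κ μ ℂ}
    {G : ι → (Fin d → ℂ) → Matrix μ ν ℂ} (hF : UniformBound (fun _ => 1) r F)
    (hG : UniformBound e r G) : UniformBound e r fun x θ => F x θ * G x θ := by
  simpa only [one_mul] using hF.mul hG

theorem mul_bounded [Fintype μ] {F : ι → (Fin d → ℂ) → Matrix κ μ ℂ}
    {G : ι → (Fin d → ℂ) → Matrix μ ν ℂ} (hF : UniformBound e r F)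
    (hG : UniformBound (fun _ => 1) r G) : UniformBound e r fun x θ => F x θ * G x θ := by
  simpa only [mul_one] using hF.mul hG

theorem fromCols {F : ι → (Fin d → ℂ) → Matrix κ μ ℂ} {G : ι → (Fin d → ℂ) → Matrix κ ν ℂ}
    (he : ∀ x, 0 ≤ e x) (hF : UniformBound e r F) (hG : UniformBound e r G) :
    UniformBound e r fun x θ => Matrix.fromCols (F x θ) (G x θ) := by
  obtain ⟨C, hC, h1⟩ := hF
  obtain ⟨C', hC', h2⟩ := hG
  refine ⟨C + C', add_nonneg hC hC', fun x θ hθ i j => ?_⟩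
  rw [add_mul]
  rcases j with j | j
  · exact (h1 x θ hθ i j).trans (le_add_of_nonneg_right (mul_nonneg hC' (he x)))
  · exact (h2 x θ hθ i j).trans (le_add_of_nonneg_left (mul_nonneg hC (he x)))

theorem fromRows {F : ι → (Fin d → ℂ) → Matrix κ ν ℂ} {G : ι → (Fin d → ℂ) → Matrix μ ν ℂ}
    (he : ∀ x, 0 ≤ e x) (hF : UniformBound e r F) (hG : UniformBound e r G) :
    UniformBound e r fun x θ => Matrix.fromRows (F x θ) (G x θ) := by
  have h := (fromCols he hF.transpose hG.transpose).transpose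
  simpa only [Matrix.transpose_fromCols, Matrix.transpose_transpose] using h

theorem zero :
    UniformBound e r fun (_ : ι) (_ : Fin d → ℂ) => (0 : Matrix κ μ ℂ) :=
  ⟨0, le_rfl, fun x θ _ i j => by simp⟩

theorem jac {l : ℕ} {r' : ℝ} (hr : r' < r) {u : ι → (Fin d → ℂ) → Fin l → ℂ} {C : ℝ}
    (hC : 0 ≤ C) (ha : ∀ x i, AnalyticOnNhd ℂ (fun θ => u x θ i) (strip d r))
    (hu : ∀ x, ∀ θ ∈ strip d r, ∀ i, ‖u x θ i‖ ≤ C * e x) :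
    UniformBound e r' fun x => EllipticTori.jac (u x) := by
  refine ⟨2 / (r - r') * C, mul_nonneg (div_nonneg zero_le_two (by linarith)) hC,
    fun x θ hθ i j => ?_⟩
  rw [mul_assoc]
  exact norm_partialDeriv_le hr (ha x i) (fun φ hφ => hu x φ hφ i) j hθ

theorem comp_compact [Finite κ] [Finite μ] {k : ℕ} {s 𝒦 : Set (Fin k → ℂ)}
    (h𝒦 : IsCompact 𝒦) (h𝒦s : 𝒦 ⊆ s) {F : (Fin k → ℂ) → Matrix κ μ ℂ} (hF : MatHolo s F)
    {K : ι → (Fin d → ℂ) → Fin k → ℂ} (hK : ∀ x, ∀ θ ∈ strip d r, K x θ ∈ 𝒦) :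
    UniformBound (fun _ => 1) r fun x θ => F (K x θ) := by
  have := Fintype.ofFinite κ
  have := Fintype.ofFinite μ
  have h : ∀ i j, ∃ C, ∀ z ∈ 𝒦, ‖F z i j‖ ≤ C := fun i j =>
    h𝒦.exists_bound_of_continuousOn ((hF i j).analytic.continuousOn.mono h𝒦s)
  choose c hc using h
  refine ⟨∑ i, ∑ j, |c i j|, by positivity, fun x θ hθ i j => ?_⟩
  rw [mul_one]
  calc ‖F (K x θ) i j‖ ≤ |c i j| := (hc i j _ (hK x θ hθ)).trans (le_abs_self _)
    _ ≤ ∑ j, |c i j| := Finset.single_le_sum (f := fun j => |c i j|)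
        (fun _ _ => abs_nonneg _) (Finset.mem_univ j)
    _ ≤ _ := Finset.single_le_sum (f := fun i => ∑ j, |c i j|)
        (fun _ _ => Finset.sum_nonneg fun _ _ => abs_nonneg _) (Finset.mem_univ i)

theorem matDeriv_comp_compact [Finite κ] [Finite μ] {k : ℕ} {s 𝒦 : Set (Fin k → ℂ)}
    (hs : IsOpen s) (h𝒦 : IsCompact 𝒦) (h𝒦s : 𝒦 ⊆ s) {F : (Fin k → ℂ) → Matrix κ μ ℂ}
    (hF : MatHolo s F) {K E : ι → (Fin d → ℂ) → Fin k → ℂ}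
    (hK : ∀ x, ∀ θ ∈ strip d r, K x θ ∈ 𝒦) (hE : ∀ x, ∀ θ ∈ strip d r, ∀ i, ‖E x θ i‖ ≤ e x) :
    UniformBound e r fun x θ => matDeriv F (K x θ) (E x θ) := by
  have h : ∀ l : Fin k, UniformBound (fun _ => 1) r
      fun x θ => matDeriv F (K x θ) (Pi.single l 1) := fun l =>
    comp_compact (F := fun z => matDeriv F z (Pi.single l 1)) h𝒦 h𝒦s
      (fun i j => (hF i j).partialDeriv hs l) hK
  choose c hc0 hc using h
  refine ⟨∑ l, c l, Finset.sum_nonneg fun l _ => hc0 l, fun x θ hθ i j => ?_⟩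
  have h1 : matDeriv F (K x θ) (E x θ) i j =
      ∑ l, E x θ l * matDeriv F (K x θ) (Pi.single l 1) i j := clm_apply_eq_sum _ _
  change ‖matDeriv F (K x θ) (E x θ) i j‖ ≤ _
  rw [h1, Finset.sum_mul]
  refine norm_sum_le_of_le _ fun l _ => ?_
  rw [norm_mul, mul_comm]
  exact mul_le_mul (by simpa using hc l x θ hθ i j) (hE x θ hθ l) (norm_nonneg _) (hc0 l)

end UniformBound

/-! ## Small perturbations of the identity matrix -/

theorem det_one_add_ne_zero {ι : Type} [Fintype ι] [DecidableEq ι] {D : Matrix ι ι ℂ} {η : ℝ}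
    (hD : ∀ i j, ‖D i j‖ ≤ η) (hη : Fintype.card ι * η ≤ 1 / 2) : (1 + D).det ≠ 0 := by
  refine det_ne_zero_of_sum_row_lt_diag fun i => ?_
  have h1 : ∑ j ∈ Finset.univ.erase i, ‖(1 + D) i j‖ = ∑ j ∈ Finset.univ.erase i, ‖D i j‖ := by
    refine Finset.sum_congr rfl fun j hj => ?_
    rw [Matrix.add_apply, Matrix.one_apply_ne (Finset.ne_of_mem_erase hj).symm, zero_add]
  have h2 : ‖D i i‖ + ∑ j ∈ Finset.univ.erase i, ‖D i j‖ = ∑ j, ‖D i j‖ :=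
    Finset.add_sum_erase _ (fun j => ‖D i j‖) (Finset.mem_univ i)
  have h3 : ∑ j, ‖D i j‖ ≤ Fintype.card ι * η := by
    simpa using Finset.sum_le_sum fun j (_ : j ∈ Finset.univ) => hD i j
  have h4 : 1 - ‖D i i‖ ≤ ‖(1 + D) i i‖ := by
    rw [Matrix.add_apply, Matrix.one_apply_eq]
    simpa using norm_sub_norm_le (1 : ℂ) (-D i i)
  linarith

/-- Use `(1 + D)⁻¹ = 1 - D (1 + D)⁻¹` at the largest entry of a column: the last term is at most
half of that entry. -/
theorem norm_inv_one_add_le {ι : Type} [Fintype ι] [DecidableEq ι] {D : Matrix ι ι ℂ} {η : ℝ}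
    (hD : ∀ i j, ‖D i j‖ ≤ η) (hη : Fintype.card ι * η ≤ 1 / 2) (i j : ι) :
    ‖(1 + D)⁻¹ i j‖ ≤ 2 := by
  have h1 : (1 + D) * (1 + D)⁻¹ = 1 :=
    Matrix.mul_nonsing_inv _ (det_one_add_ne_zero hD hη).isUnit
  have : Nonempty ι := ⟨i⟩
  obtain ⟨p, hp⟩ := Finite.exists_max fun p => ‖(1 + D)⁻¹ p j‖
  have h2 : (1 + D)⁻¹ p j = (1 : Matrix ι ι ℂ) p j - ∑ l, D p l * (1 + D)⁻¹ l j := by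
    have h3 : (1 + D)⁻¹ = 1 - D * (1 + D)⁻¹ := by
      rw [Matrix.add_mul, Matrix.one_mul] at h1
      exact eq_sub_of_add_eq h1
    exact congrFun (congrFun h3 p) j
  have h3 : ‖(1 : Matrix ι ι ℂ) p j‖ ≤ 1 := by
    by_cases h : p = j <;> simp [Matrix.one_apply, h]
  have h4 : ‖∑ l, D p l * (1 + D)⁻¹ l j‖ ≤ (Fintype.card ι * η) * ‖(1 + D)⁻¹ p j‖ := by
    have : ‖∑ l, D p l * (1 + D)⁻¹ l j‖ ≤ ∑ _l : ι, η * ‖(1 + D)⁻¹ p j‖ := by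
      refine norm_sum_le_of_le _ fun l _ => ?_
      rw [norm_mul]
      exact mul_le_mul (hD p l) (hp l) (norm_nonneg _) ((norm_nonneg _).trans (hD p l))
    simpa [mul_assoc] using this
  have h5 : ‖(1 + D)⁻¹ p j‖ ≤ 1 + 1 / 2 * ‖(1 + D)⁻¹ p j‖ := by
    conv_lhs => rw [h2]
    exact (norm_sub_le _ _).trans (add_le_add h3
      (h4.trans (mul_le_mul_of_nonneg_right hη (norm_nonneg _))))
  have : ‖(1 + D)⁻¹ i j‖ ≤ ‖(1 + D)⁻¹ p j‖ := hp i
  linarith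

end EllipticTori

namespace EllipticTori

/-! ## Approximately invariant tori and bundles -/

variable {n d : ℕ}

/-- A torus and a bundle with invariance errors of size at most `err`. -/
structure ApproxTorus (S : CompatibleTriple n)
    (h : (Fin (n - d) → ℝ) → (Fin (2 * n) → ℂ) → ℂ) (Λ : Set (Fin (n - d) → ℝ))
    (ω : Fin d → ℝ) (β : Fin (n - d) → ℝ) (𝒦 : Set (Fin (2 * n) → ℂ)) (ρ M : ℝ) where
  K : (Fin d → ℂ) → Fin (2 * n) → ℂ
  W : MatMap n d (NormalIdx n d)
  lam : Fin (n - d) → ℝ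
  α : Fin (n - d) → ℝ
  err : ℝ
  lam_mem : lam ∈ Λ
  K_torus : ∀ i, IsTorusFun ρ fun θ => K θ i
  W_torus : ∀ i j, IsTorusFun ρ fun θ => W θ i j
  K_mem : ∀ θ ∈ strip d ρ, K θ ∈ 𝒦
  det_LL : ∀ θ ∈ strip d ρ, (pairG S K (frameL K) (frameL K) θ).det ≠ 0
  det_WW : ∀ θ ∈ strip d ρ, (pairΩ S K W W θ).det ≠ 0
  norm_W_le : ∀ θ ∈ strip d ρ, ∀ i j, ‖W θ i j‖ ≤ M
  norm_B_le : ∀ θ ∈ strip d ρ, ∀ i j, ‖(pairG S K (frameL K) (frameL K) θ)⁻¹ i j‖ ≤ M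
  norm_inv_WW_le : ∀ θ ∈ strip d ρ, ∀ i j, ‖(pairΩ S K W W θ)⁻¹ i j‖ ≤ M
  norm_errK_le : ∀ θ ∈ strip d ρ, ∀ i, ‖errK S (h lam) ω K θ i‖ ≤ err
  norm_errW_le : ∀ θ ∈ strip d ρ, ∀ i j, ‖errW S (h lam) ω α β K W θ i j‖ ≤ err
  err_nonneg : 0 ≤ err

namespace ApproxTorus

variable {S : CompatibleTriple n} {h : (Fin (n - d) → ℝ) → (Fin (2 * n) → ℂ) → ℂ}
  {Λ : Set (Fin (n - d) → ℝ)} {ω : Fin d → ℝ} {β : Fin (n - d) → ℝ}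
  {𝒦 : Set (Fin (2 * n) → ℂ)} {ρ M : ℝ}

/-! ### Holomorphy and periodicity of the frame, and the zero mean of `X` -/

section Regularity

variable (x : ApproxTorus S h Λ ω β 𝒦 ρ M)

theorem K_holo (i : Fin (2 * n)) : IsRealHolomorphicOn (strip d ρ) fun θ => x.K θ i :=
  (x.K_torus i).holo

theorem W_holo : MatHolo (strip d ρ) x.W := fun i j => (x.W_torus i j).holo

theorem L_holo : MatHolo (strip d ρ) (frameL x.K) := matHolo_jac (isOpen_strip d ρ) x.K_holo

theorem comp_K_holo {κ μ : Type} (h𝒦S : 𝒦 ⊆ S.domain)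
    {F : (Fin (2 * n) → ℂ) → Matrix κ μ ℂ} (hF : MatHolo S.domain F) :
    MatHolo (strip d ρ) fun θ => F (x.K θ) :=
  hF.comp x.K_holo fun θ hθ => h𝒦S (x.K_mem θ hθ)

theorem pairΩ_holo (h𝒦S : 𝒦 ⊆ S.domain) {κ₁ κ₂ : Type} {V₁ : MatMap n d κ₁}
    {V₂ : MatMap n d κ₂} (h₁ : MatHolo (strip d ρ) V₁) (h₂ : MatHolo (strip d ρ) V₂) :
    MatHolo (strip d ρ) (pairΩ S x.K V₁ V₂) :=
  (h₁.transpose.mul (x.comp_K_holo h𝒦S S.matHolo_Ω)).mul h₂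

theorem pairG_holo (h𝒦S : 𝒦 ⊆ S.domain) {κ₁ κ₂ : Type} {V₁ : MatMap n d κ₁}
    {V₂ : MatMap n d κ₂} (h₁ : MatHolo (strip d ρ) V₁) (h₂ : MatHolo (strip d ρ) V₂) :
    MatHolo (strip d ρ) (pairG S x.K V₁ V₂) :=
  (h₁.transpose.mul (x.comp_K_holo h𝒦S S.G_holo)).mul h₂

theorem B_holo (h𝒦S : 𝒦 ⊆ S.domain) : MatHolo (strip d ρ) (matB S x.K) :=
  (x.pairG_holo h𝒦S x.L_holo x.L_holo).inv x.det_LL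

theorem inv_WW_holo (h𝒦S : 𝒦 ⊆ S.domain) :
    MatHolo (strip d ρ) fun θ => (pairΩ S x.K x.W x.W θ)⁻¹ :=
  (x.pairΩ_holo h𝒦S x.W_holo x.W_holo).inv x.det_WW

theorem C_holo (h𝒦S : 𝒦 ⊆ S.domain) : MatHolo (strip d ρ) (matC S x.K x.W) :=
  ((x.inv_WW_holo h𝒦S).mul (x.pairG_holo h𝒦S x.W_holo x.L_holo)).mul (x.B_holo h𝒦S)

theorem A_holo (h𝒦S : 𝒦 ⊆ S.domain) : MatHolo (strip d ρ) (matA S x.K x.W) :=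
  .smul (by simp) (((x.C_holo h𝒦S).transpose.mul (x.pairΩ_holo h𝒦S x.W_holo x.W_holo)).mul
    (x.C_holo h𝒦S))

theorem N_holo (h𝒦S : 𝒦 ⊆ S.domain) : MatHolo (strip d ρ) (frameN S x.K x.W) :=
  ((x.L_holo.mul (x.A_holo h𝒦S)).add
    (((x.comp_K_holo h𝒦S S.J_holo).mul x.L_holo).mul (x.B_holo h𝒦S))).add
    (x.W_holo.mul (x.C_holo h𝒦S))

theorem P_holo (h𝒦S : 𝒦 ⊆ S.domain) : MatHolo (strip d ρ) (frameP S x.K x.W) :=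
  x.L_holo.fromCols ((x.N_holo h𝒦S).fromCols x.W_holo)

theorem approxInv_holo (h𝒦S : 𝒦 ⊆ S.domain) : MatHolo (strip d ρ) (approxInv S x.K x.W) :=
  have hΩ := x.comp_K_holo h𝒦S S.matHolo_Ω
  ((x.N_holo h𝒦S).transpose.mul hΩ).fromRows ((x.L_holo.transpose.neg.mul hΩ).fromRows
    (((x.inv_WW_holo h𝒦S).mul x.W_holo.transpose).mul hΩ))

variable {x} {θ : Fin d → ℂ}

theorem K_periodic (hθ : θ ∈ strip d ρ) (i : Fin d) :
    x.K (θ + Pi.single i (2 * (Real.pi : ℂ))) = x.K θ :=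
  funext fun l => (x.K_torus l).periodic θ hθ i

theorem W_periodic (hθ : θ ∈ strip d ρ) (i : Fin d) :
    x.W (θ + Pi.single i (2 * (Real.pi : ℂ))) = x.W θ :=
  Matrix.ext fun p q => (x.W_torus p q).periodic θ hθ i

theorem L_periodic (hθ : θ ∈ strip d ρ) (i : Fin d) :
    frameL x.K (θ + Pi.single i (2 * (Real.pi : ℂ))) = frameL x.K θ := by
  ext p q
  simp only [frameL, jac, Matrix.of_apply]
  rw [fderiv_periodic (fun φ hφ => (x.K_torus p).periodic φ hφ i) hθ]

theorem P_periodic (hθ : θ ∈ strip d ρ) (i : Fin d) :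
    frameP S x.K x.W (θ + Pi.single i (2 * (Real.pi : ℂ))) = frameP S x.K x.W θ := by
  simp only [frameP, frameN, matA, matB, matC, pairΩ, pairG, K_periodic hθ, W_periodic hθ,
    L_periodic hθ]

theorem approxInv_periodic (hθ : θ ∈ strip d ρ) (i : Fin d) :
    approxInv S x.K x.W (θ + Pi.single i (2 * (Real.pi : ℂ))) = approxInv S x.K x.W θ := by
  simp only [approxInv, frameN, matA, matB, matC, pairΩ, pairG, K_periodic hθ, W_periodic hθ,
    L_periodic hθ]

theorem pairΩ_LL_isPeriodicHolo (h𝒦S : 𝒦 ⊆ S.domain) (i j : Fin d) :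
    IsPeriodicHolo ρ fun θ => pairΩ S x.K (frameL x.K) (frameL x.K) θ i j :=
  ⟨(x.pairΩ_holo h𝒦S x.L_holo x.L_holo i j).analytic, fun θ hθ i => by
    simp only [pairΩ, K_periodic hθ, L_periodic hθ]⟩

theorem pairΩ_LW_isPeriodicHolo (h𝒦S : 𝒦 ⊆ S.domain) (i : Fin d) (j : NormalIdx n d) :
    IsPeriodicHolo ρ fun θ => pairΩ S x.K (frameL x.K) x.W θ i j :=
  ⟨(x.pairΩ_holo h𝒦S x.L_holo x.W_holo i j).analytic, fun θ hθ i => by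
    simp only [pairΩ, K_periodic hθ, L_periodic hθ, W_periodic hθ]⟩

/-- The pull-back of the two-form has zero average, by exactness. -/
theorem coef_pairΩ_LL_zero (h𝒦S : 𝒦 ⊆ S.domain) (i j : Fin d) {y : Fin d → ℝ}
    (hy : ∀ i, |y i| < ρ) :
    coef (slice (fun θ => pairΩ S x.K (frameL x.K) (frameL x.K) θ i j) y) 0 = 0 := by
  let b : Fin d → (Fin d → ℂ) → ℂ := fun j φ => ∑ m, S.a (x.K φ) m * frameL x.K φ m j
  have hb : ∀ j, IsPeriodicHolo ρ (b j) := fun j =>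
    .sum _ fun m _ => .mul
      ⟨((S.a_holo m).comp x.K_holo fun θ hθ => h𝒦S (x.K_mem θ hθ)).analytic,
        fun θ hθ i => by rw [K_periodic hθ]⟩
      ⟨(x.L_holo m j).analytic, fun θ hθ i => by rw [L_periodic hθ]⟩
  have hzero : ∀ i j, coef (slice (fun θ => fderiv ℂ (b j) θ (Pi.single i 1)) y) 0 = 0 := by
    intro i j
    have := (hb j).coef_slice_fderiv hy (Pi.single i 1) 0
    rw [toComplex_single] at this
    rw [this]
    simp
  have h1 : slice (fun θ => pairΩ S x.K (frameL x.K) (frameL x.K) θ i j) y = fun t =>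
      slice (fun θ => fderiv ℂ (b j) θ (Pi.single i 1)) y t +
      (-1) * slice (fun θ => fderiv ℂ (b i) θ (Pi.single j 1)) y t := by
    funext t
    have := pairΩ_frameL_eq (S := S) x.K_holo (fun θ hθ => h𝒦S (x.K_mem θ hθ))
      (slice_mem_strip hy t) i j
    simp only [slice]
    rw [this]
    ring
  have h2 : IsContPeriodic fun t =>
      (-1) * slice (fun θ => fderiv ℂ (b i) θ (Pi.single j 1)) y t :=
    (((hb i).fderiv_apply _).const_mul (-1)).isContPeriodic_slice hy
  rw [h1, coef_add (((hb j).fderiv_apply _).isContPeriodic_slice hy) h2, coef_const_mul,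
    hzero, hzero]
  simp

end Regularity

/-! ## The frame is almost symplectic -/

theorem uniformBound_Ω (h𝒦 : IsCompact 𝒦) (h𝒦S : 𝒦 ⊆ S.domain) :
    UniformBound (fun _ => 1) ρ fun (x : ApproxTorus S h Λ ω β 𝒦 ρ M) θ => S.Ω (x.K θ) :=
  .comp_compact h𝒦 h𝒦S S.matHolo_Ω fun x => x.K_mem

/-- `K` takes values in a compact set, so Cauchy's estimate bounds `D K` on any narrower strip. -/
theorem uniformBound_L (h𝒦 : IsCompact 𝒦) {r : ℝ} (hr : r < ρ) :
    UniformBound (fun _ => 1) r fun (x : ApproxTorus S h Λ ω β 𝒦 ρ M) => frameL x.K := by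
  obtain ⟨c, hc⟩ := h𝒦.exists_bound_of_continuousOn continuousOn_id
  refine .jac hr (abs_nonneg c) (fun x i => (x.K_holo i).analytic) fun x θ hθ i => ?_
  rw [mul_one]
  exact (norm_le_pi_norm _ i).trans ((hc _ (x.K_mem θ hθ)).trans (le_abs_self c))

theorem uniformBound_W (hM : 0 ≤ M) :
    UniformBound (fun _ => 1) ρ fun (x : ApproxTorus S h Λ ω β 𝒦 ρ M) => x.W :=
  ⟨M, hM, fun x θ hθ i j => by simpa using x.norm_W_le θ hθ i j⟩

theorem uniformBound_jac_errK (hh : ∀ lam ∈ Λ, IsRealHolomorphicOn S.domain (h lam))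
    (h𝒦S : 𝒦 ⊆ S.domain) {r : ℝ} (hr : r < ρ) :
    UniformBound err r fun (x : ApproxTorus S h Λ ω β 𝒦 ρ M) =>
      jac (errK S (h x.lam) ω x.K) :=
  .jac hr zero_le_one (fun x i => (errK_holo (hh _ x.lam_mem) x.K_holo
    (fun θ hθ => h𝒦S (x.K_mem θ hθ)) i).analytic) fun x θ hθ i => by
      simpa using x.norm_errK_le θ hθ i

theorem uniformBound_matDeriv_Ω (h𝒦 : IsCompact 𝒦) (h𝒦S : 𝒦 ⊆ S.domain) :
    UniformBound err ρ fun (x : ApproxTorus S h Λ ω β 𝒦 ρ M) θ =>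
      matDeriv S.Ω (x.K θ) (errK S (h x.lam) ω x.K θ) :=
  .matDeriv_comp_compact S.isOpen_domain h𝒦 h𝒦S S.matHolo_Ω (fun x => x.K_mem)
    fun x => x.norm_errK_le

theorem matDeriv_pairΩ_LL (hh : ∀ lam ∈ Λ, IsRealHolomorphicOn S.domain (h lam))
    (h𝒦S : 𝒦 ⊆ S.domain) (x : ApproxTorus S h Λ ω β 𝒦 ρ M) {θ : Fin d → ℂ}
    (hθ : θ ∈ strip d ρ) :
    matDeriv (pairΩ S x.K (frameL x.K) (frameL x.K)) θ (toComplex ω) =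
      -((jac (errK S (h x.lam) ω x.K) θ)ᵀ * S.Ω (x.K θ) * frameL x.K θ) -
        (frameL x.K θ)ᵀ * S.Ω (x.K θ) * jac (errK S (h x.lam) ω x.K) θ -
        (frameL x.K θ)ᵀ * matDeriv S.Ω (x.K θ) (errK S (h x.lam) ω x.K θ) * frameL x.K θ :=
  have hKS : ∀ θ ∈ strip d ρ, x.K θ ∈ S.domain := fun θ hθ => h𝒦S (x.K_mem θ hθ)
  have hL := matDeriv_frameL (ω := ω) (hh _ x.lam_mem) x.K_holo hKS hθ
  matDeriv_pairΩ (hh _ x.lam_mem) x.K_holo hKS x.L_holo x.L_holo hθ hL hL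

/-- The remainder of `W` in the linearised equation is `W Γ + E_W`; its first part is what becomes
`Y Γ` on the left. -/
theorem matDeriv_pairΩ_LW (hh : ∀ lam ∈ Λ, IsRealHolomorphicOn S.domain (h lam))
    (h𝒦S : 𝒦 ⊆ S.domain) (x : ApproxTorus S h Λ ω β 𝒦 ρ M) {θ : Fin d → ℂ}
    (hθ : θ ∈ strip d ρ) :
    matDeriv (pairΩ S x.K (frameL x.K) x.W) θ (toComplex ω) +
        pairΩ S x.K (frameL x.K) x.W θ * Gam x.α β =
      -((jac (errK S (h x.lam) ω x.K) θ)ᵀ * S.Ω (x.K θ) * x.W θ) -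
        (frameL x.K θ)ᵀ * S.Ω (x.K θ) * errW S (h x.lam) ω x.α β x.K x.W θ -
        (frameL x.K θ)ᵀ * matDeriv S.Ω (x.K θ) (errK S (h x.lam) ω x.K θ) * x.W θ := by
  have hKS : ∀ θ ∈ strip d ρ, x.K θ ∈ S.domain := fun θ hθ => h𝒦S (x.K_mem θ hθ)
  rw [matDeriv_pairΩ (hh _ x.lam_mem) x.K_holo hKS x.L_holo x.W_holo hθ
    (matDeriv_frameL (hh _ x.lam_mem) x.K_holo hKS hθ) (matDeriv_W (α := x.α) (β := β) θ)]
  simp only [pairΩ, Matrix.mul_add, Matrix.mul_assoc]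
  abel

theorem norm_I_mul_sum (k : Fin d → ℤ) (ω : Fin d → ℝ) :
    ‖Complex.I * ∑ i, (k i : ℂ) * (ω i : ℂ)‖ = |∑ i, (k i : ℝ) * ω i| := by
  rw [norm_mul, Complex.norm_I, one_mul, ← Real.norm_eq_abs, ← Complex.norm_real]
  push_cast
  rfl

/-- Half of the width pays for `D K` and `D E_K`, the other half for the small divisors. Exactness
kills the mean, so `c = 0` and `c₀ = 0` are admissible. -/
theorem uniformBound_pairΩ_LL (hh : ∀ lam ∈ Λ, IsRealHolomorphicOn S.domain (h lam))
    {γ τ : ℝ} (hDM : DiophantineMelnikov ω β γ τ) (h𝒦 : IsCompact 𝒦) (h𝒦S : 𝒦 ⊆ S.domain)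
    {r : ℝ} (hr : r < ρ) :
    UniformBound err r fun (x : ApproxTorus S h Λ ω β 𝒦 ρ M) =>
      pairΩ S x.K (frameL x.K) (frameL x.K) := by
  have hr₁ : (r + ρ) / 2 < ρ := by linarith
  have hΩ := (uniformBound_Ω (h := h) (Λ := Λ) (ω := ω) (β := β) (M := M) h𝒦 h𝒦S).mono hr₁.le
  have hL := uniformBound_L (S := S) (h := h) (Λ := Λ) (ω := ω) (β := β) (M := M) h𝒦 hr₁
  have hE := uniformBound_jac_errK (ω := ω) (β := β) (M := M) hh h𝒦S hr₁
  have hD := (uniformBound_matDeriv_Ω (h := h) (Λ := Λ) (ω := ω) (β := β) (M := M)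
    h𝒦 h𝒦S).mono hr₁.le
  obtain ⟨c, hc0, hc⟩ := (((hE.transpose.mul_bounded hΩ).mul_bounded hL).neg.sub
    ((hL.transpose.bounded_mul hΩ).bounded_mul hE)).sub
    ((hL.transpose.bounded_mul hD).mul_bounded hL)
  beta_reduce at hc
  obtain ⟨C, hC0, hC⟩ := exists_norm_le_of_small_divisors ω hDM.γ_pos hDM.τ_gt
    (show r < (r + ρ) / 2 by linarith)
  refine ⟨(0 + C) * c, by positivity, fun x θ hθ i j => ?_⟩
  rw [mul_assoc]
  refine hC (fun θ => pairΩ S x.K (frameL x.K) (frameL x.K) θ i j) 0 0 _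
    ((pairΩ_LL_isPeriodicHolo h𝒦S i j).mono hr₁.le) (fun θ hθ => ?_) (fun k hk => ?_)
    (fun y hy => ?_) θ hθ
  · have h1 := hc x θ hθ i j
    rw [← matDeriv_pairΩ_LL hh h𝒦S x (strip_mono hr₁.le hθ)] at h1
    simp only [zero_mul, add_zero]
    exact h1
  · rw [zero_add, norm_I_mul_sum]
    exact hDM.diophantine k hk
  · rw [coef_pairΩ_LL_zero h𝒦S i j fun i => (hy i).trans hr₁]
    simp

theorem mul_Gam_inl {κ : Type} {m : ℕ} (U : Matrix κ (Fin m ⊕ Fin m) ℂ) (α β : Fin m → ℝ)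
    (a : κ) (i : Fin m) :
    (U * Gam α β) a (.inl i) = U a (.inl i) * α i + U a (.inr i) * β i := by
  simp [Gam, Matrix.mul_apply, Matrix.diagonal_apply, toComplex]

theorem mul_Gam_inr {κ : Type} {m : ℕ} (U : Matrix κ (Fin m ⊕ Fin m) ℂ) (α β : Fin m → ℝ)
    (a : κ) (i : Fin m) :
    (U * Gam α β) a (.inr i) = -(U a (.inl i) * β i) + U a (.inr i) * α i := by
  simp [Gam, Matrix.mul_apply, Matrix.diagonal_apply, toComplex]

/-- The real number `a` (later `α_i`) enters only the real part, so the imaginary part alone gives a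
bound uniform in it. For `σ = -1` the Melnikov condition is used at `-k`. -/
theorem melnikov_norm_le {γ τ : ℝ} (hDM : DiophantineMelnikov ω β γ τ) {σ : ℝ}
    (hσ : σ = 1 ∨ σ = -1) (a : ℝ) (i : Fin (n - d)) {k : Fin d → ℤ} (hk : k ≠ 0) :
    γ / (∑ l, |(k l : ℝ)|) ^ τ ≤
      ‖(a - σ * Complex.I * β i : ℂ) + Complex.I * ∑ l, (k l : ℂ) * (ω l : ℂ)‖ := by
  have him : ((a - σ * Complex.I * β i : ℂ) + Complex.I * ∑ l, (k l : ℂ) * (ω l : ℂ)).im =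
      (∑ l, (k l : ℝ) * ω l) - σ * β i := by
    have : (∑ l, (k l : ℂ) * (ω l : ℂ)) = ((∑ l, (k l : ℝ) * ω l : ℝ) : ℂ) := by push_cast; rfl
    rw [this]
    simp
    ring
  refine le_trans ?_ (Complex.abs_im_le_norm _)
  rw [him]
  rcases hσ with rfl | rfl
  · simpa using hDM.melnikov_one k hk i
  · have h1 := hDM.melnikov_one (-k) (neg_ne_zero.2 hk) i
    simp only [Pi.neg_apply, Int.cast_neg, abs_neg, neg_mul, Finset.sum_neg_distrib] at h1
    rw [← abs_neg]
    refine h1.trans (le_of_eq (congrArg _ ?_))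
    ring

theorem abs_β_le_norm {σ : ℝ} (hσ : σ = 1 ∨ σ = -1) (a b : ℝ) :
    |b| ≤ ‖(a - σ * Complex.I * b : ℂ)‖ := by
  have h1 := Complex.abs_im_le_norm (a - σ * Complex.I * b : ℂ)
  rcases hσ with rfl | rfl <;> simpa using h1

/-- The vectors `(1, ±i)` diagonalise `Γ`: the combination `Y_inl + σ i Y_inr` solves a scalar
equation with constant `α_i - σ i β_i`. The columns of `Y` are recovered from the cases `σ = 1` and
`σ = -1`. -/
theorem uniformBound_pairΩ_LW (hh : ∀ lam ∈ Λ, IsRealHolomorphicOn S.domain (h lam))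
    {γ τ : ℝ} (hDM : DiophantineMelnikov ω β γ τ) (h𝒦 : IsCompact 𝒦) (h𝒦S : 𝒦 ⊆ S.domain)
    (hM : 0 ≤ M) {r : ℝ} (hr : r < ρ) :
    UniformBound err r fun (x : ApproxTorus S h Λ ω β 𝒦 ρ M) =>
      pairΩ S x.K (frameL x.K) x.W := by
  have hr₁ : (r + ρ) / 2 < ρ := by linarith
  have hΩ := (uniformBound_Ω (h := h) (Λ := Λ) (ω := ω) (β := β) (M := M) h𝒦 h𝒦S).mono hr₁.le
  have hL := uniformBound_L (S := S) (h := h) (Λ := Λ) (ω := ω) (β := β) (M := M) h𝒦 hr₁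
  have hW := (uniformBound_W (S := S) (h := h) (Λ := Λ) (ω := ω) (β := β) (𝒦 := 𝒦) (ρ := ρ)
    hM).mono hr₁.le
  have hE := uniformBound_jac_errK (ω := ω) (β := β) (M := M) hh h𝒦S hr₁
  have hEW : UniformBound err ((r + ρ) / 2) fun (x : ApproxTorus S h Λ ω β 𝒦 ρ M) =>
      errW S (h x.lam) ω x.α β x.K x.W :=
    ⟨1, zero_le_one, fun x θ hθ i j => by
      simpa using x.norm_errW_le θ (strip_mono hr₁.le hθ) i j⟩
  have hD := (uniformBound_matDeriv_Ω (h := h) (Λ := Λ) (ω := ω) (β := β) (M := M)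
    h𝒦 h𝒦S).mono hr₁.le
  obtain ⟨c, hc0, hc⟩ := (((hE.transpose.mul_bounded hΩ).mul_bounded hW).neg.sub
    ((hL.transpose.bounded_mul hΩ).bounded_mul hEW)).sub
    ((hL.transpose.bounded_mul hD).mul_bounded hW)
  beta_reduce at hc
  obtain ⟨C, hC0, hC⟩ := exists_norm_le_of_small_divisors ω hDM.γ_pos hDM.τ_gt
    (show r < (r + ρ) / 2 by linarith)
  have hβ0 : 0 ≤ ∑ i, |β i|⁻¹ := Finset.sum_nonneg fun _ _ => by positivity
  have key : ∀ (x : ApproxTorus S h Λ ω β 𝒦 ρ M) (σ : ℝ), (σ = 1 ∨ σ = -1) →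
      ∀ (a : Fin d) (i : Fin (n - d)), ∀ θ ∈ strip d r,
      ‖pairΩ S x.K (frameL x.K) x.W θ a (.inl i) +
        σ * Complex.I * pairΩ S x.K (frameL x.K) x.W θ a (.inr i)‖ ≤
        (∑ i, |β i|⁻¹ + C) * (2 * (c * x.err)) := by
    intro x σ hσ a i
    have hσn : ‖(σ * Complex.I : ℂ)‖ = 1 := by rcases hσ with rfl | rfl <;> simp
    have hσ2 : (σ : ℂ) * σ = 1 := by rcases hσ with rfl | rfl <;> simp
    have hU : ∀ j, IsPeriodicHolo ((r + ρ) / 2)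
        fun θ => pairΩ S x.K (frameL x.K) x.W θ a j := fun j =>
      (pairΩ_LW_isPeriodicHolo h𝒦S a j).mono hr₁.le
    have hZ := (hU (.inl i)).add ((hU (.inr i)).const_mul (σ * Complex.I))
    have hbound : ∀ θ ∈ strip d ((r + ρ) / 2),
        ‖fderiv ℂ (fun θ => pairΩ S x.K (frameL x.K) x.W θ a (.inl i) +
          σ * Complex.I * pairΩ S x.K (frameL x.K) x.W θ a (.inr i)) θ (toComplex ω) +
        (x.α i - σ * Complex.I * β i : ℂ) * (pairΩ S x.K (frameL x.K) x.W θ a (.inl i) +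
          σ * Complex.I * pairΩ S x.K (frameL x.K) x.W θ a (.inr i))‖ ≤ 2 * (c * x.err) := by
      intro θ hθ
      have h1 := hc x θ hθ a (.inl i)
      have h2 := hc x θ hθ a (.inr i)
      rw [← matDeriv_pairΩ_LW hh h𝒦S x (strip_mono hr₁.le hθ), Matrix.add_apply, mul_Gam_inl]
        at h1
      rw [← matDeriv_pairΩ_LW hh h𝒦S x (strip_mono hr₁.le hθ), Matrix.add_apply, mul_Gam_inr]
        at h2
      have hd := fun j => ((hU j).analytic θ hθ).differentiableAt
      rw [fderiv_fun_add (hd _) ((hd _).const_mul _), fderiv_const_mul (hd _)]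
      set u₁ := pairΩ S x.K (frameL x.K) x.W θ a (.inl i)
      set u₂ := pairΩ S x.K (frameL x.K) x.W θ a (.inr i)
      set D₁ := matDeriv (pairΩ S x.K (frameL x.K) x.W) θ (toComplex ω) a (.inl i) with hD₁
      set D₂ := matDeriv (pairΩ S x.K (frameL x.K) x.W) θ (toComplex ω) a (.inr i) with hD₂
      have heq : D₁ + σ * Complex.I * D₂ + (x.α i - σ * Complex.I * β i : ℂ) *
          (u₁ + σ * Complex.I * u₂) = (D₁ + (u₁ * x.α i + u₂ * β i)) +
          σ * Complex.I * (D₂ + (-(u₁ * β i) + u₂ * x.α i)) := by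
        linear_combination (-(β i) * u₂ * Complex.I ^ 2) * hσ2 - β i * u₂ * Complex.I_sq
      change ‖D₁ + σ * Complex.I * D₂ + (x.α i - σ * Complex.I * β i : ℂ) *
          (u₁ + σ * Complex.I * u₂)‖ ≤ _
      rw [heq, two_mul]
      refine (norm_add_le _ _).trans (add_le_add h1 ?_)
      rw [norm_mul, hσn, one_mul]
      exact h2
    refine hC _ (x.α i - σ * Complex.I * β i) _ _ hZ hbound
      (fun k hk => melnikov_norm_le hDM hσ _ i hk) fun y hy => ?_
    -- At `k = 0` the equation divides by `α_i - σ i β_i`, of modulus at least `|β_i|`; the sum of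
    -- all `|β_i|⁻¹` serves as one `c₀` for every `i`.
    have h0 := hZ.coef_slice_of_fderiv_add (ω := ω) (c := (x.α i - σ * Complex.I * β i : ℂ))
      (fun _ _ => rfl) hy 0
    simp only [Pi.zero_apply, Int.cast_zero, zero_mul, Finset.sum_const_zero, mul_zero,
      add_zero] at h0
    have h1 := norm_coef_le (k := 0) fun t => hbound _ (slice_mem_strip hy t)
    have h2 := congrArg norm h0
    rw [norm_mul] at h2
    have h3 := h2.le.trans h1
    have hβ : 0 < |β i| := abs_pos.2 (hDM.β_ne_zero i)
    have h4 := (mul_le_mul_of_nonneg_right (abs_β_le_norm hσ (x.α i) (β i))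
      (norm_nonneg _)).trans h3
    rw [← le_inv_mul_iff₀ hβ] at h4
    refine h4.trans (mul_le_mul_of_nonneg_right ?_
      (mul_nonneg zero_le_two (mul_nonneg hc0 x.err_nonneg)))
    exact Finset.single_le_sum (f := fun i => |β i|⁻¹) (fun _ _ => by positivity)
      (Finset.mem_univ i)
  refine ⟨(∑ i, |β i|⁻¹ + C) * (2 * c), by positivity, fun x θ hθ a j => ?_⟩
  have hplus := fun i => key x 1 (Or.inl rfl) a i θ hθ
  have hminus := fun i => key x (-1) (Or.inr rfl) a i θ hθ
  have hhalf : ∀ p q : ℂ, ‖p‖ ≤ (∑ i, |β i|⁻¹ + C) * (2 * (c * x.err)) →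
      ‖q‖ ≤ (∑ i, |β i|⁻¹ + C) * (2 * (c * x.err)) →
      ‖(p + q) / 2‖ ≤ (∑ i, |β i|⁻¹ + C) * (2 * c) * x.err := by
    intro p q hp hq
    rw [norm_div, Complex.norm_two]
    have := norm_add_le p q
    linarith
  rcases j with i | i
  · convert hhalf _ _ (hplus i) (hminus i) using 2
    push_cast
    ring
  · have hm := hminus i
    rw [← norm_neg] at hm
    have := hhalf _ _ (hplus i) hm
    have heq : pairΩ S x.K (frameL x.K) x.W θ a (.inr i) = -(Complex.I *
        ((pairΩ S x.K (frameL x.K) x.W θ a (.inl i) +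
          (1 : ℝ) * Complex.I * pairΩ S x.K (frameL x.K) x.W θ a (.inr i) +
        -(pairΩ S x.K (frameL x.K) x.W θ a (.inl i) +
          (-1 : ℝ) * Complex.I * pairΩ S x.K (frameL x.K) x.W θ a (.inr i))) / 2)) := by
      push_cast
      linear_combination pairΩ S x.K (frameL x.K) x.W θ a (.inr i) * Complex.I_sq
    refine le_of_eq_of_le ((congrArg norm heq).trans ?_) this
    rw [norm_neg, norm_mul, Complex.norm_I, one_mul]

end ApproxTorus

end EllipticTori

namespace EllipticTori

/-! ## The inverse of the adapted frame -/

variable {n d : ℕ}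

namespace ApproxTorus

variable {S : CompatibleTriple n} {h : (Fin (n - d) → ℝ) → (Fin (2 * n) → ℂ) → ℂ}
  {Λ : Set (Fin (n - d) → ℝ)} {ω : Fin d → ℝ} {β : Fin (n - d) → ℝ}
  {𝒦 : Set (Fin (2 * n) → ℂ)} {ρ M : ℝ}

theorem isAdaptedFrame (h𝒦S : 𝒦 ⊆ S.domain) (x : ApproxTorus S h Λ ω β 𝒦 ρ M)
    {θ : Fin d → ℂ} (hθ : θ ∈ strip d ρ) :
    IsAdaptedFrame (S.Ω (x.K θ)) (S.G (x.K θ)) (S.J (x.K θ)) (frameL x.K θ)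
      (frameN S x.K x.W θ) (x.W θ) (matA S x.K x.W θ) (matB S x.K θ) (matC S x.K x.W θ) where
  Ω_transpose := S.Ω_transpose _
  G_transpose := S.G_symm _ (h𝒦S (x.K_mem θ hθ))
  J_sq := S.J_sq _ (h𝒦S (x.K_mem θ hθ))
  compatible := S.compatible _ (h𝒦S (x.K_mem θ hθ))
  B_inv := Matrix.mul_nonsing_inv _ (x.det_LL θ hθ).isUnit
  C_eq := by
    change pairΩ S x.K x.W x.W θ * matC S x.K x.W θ = _
    rw [matC, Matrix.mul_assoc, ← Matrix.mul_assoc,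
      Matrix.mul_nonsing_inv _ (x.det_WW θ hθ).isUnit, Matrix.one_mul]
    rfl
  A_eq := rfl
  N_eq := rfl

/-- The deviation of `approxInv * P` from the identity. -/
def defect (x : ApproxTorus S h Λ ω β 𝒦 ρ M) (θ : Fin d → ℂ) :
    Matrix (FrameIdx n d) (FrameIdx n d) ℂ :=
  frameDefect (matA S x.K x.W θ) (matB S x.K θ) (matC S x.K x.W θ)
    (pairΩ S x.K (frameL x.K) (frameL x.K) θ) (pairΩ S x.K (frameL x.K) x.W θ)
    (pairΩ S x.K x.W x.W θ)⁻¹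

theorem approxInv_mul_frameP (h𝒦S : 𝒦 ⊆ S.domain) (x : ApproxTorus S h Λ ω β 𝒦 ρ M)
    {θ : Fin d → ℂ} (hθ : θ ∈ strip d ρ) :
    approxInv S x.K x.W θ * frameP S x.K x.W θ = 1 + x.defect θ :=
  (x.isAdaptedFrame h𝒦S hθ).approxInv_mul (x.det_WW θ hθ)

/-! ### Uniform bounds for the frame, its approximate inverse and the defect -/

section Bounds

variable (S h Λ ω β M)

theorem uniformBound_B (hM : 0 ≤ M) :
    UniformBound (fun _ => 1) ρ fun x : ApproxTorus S h Λ ω β 𝒦 ρ M => matB S x.K :=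
  ⟨M, hM, fun x θ hθ i j => by simpa using! x.norm_B_le θ hθ i j⟩

theorem uniformBound_inv_WW (hM : 0 ≤ M) :
    UniformBound (fun _ => 1) ρ fun (x : ApproxTorus S h Λ ω β 𝒦 ρ M) θ =>
      (pairΩ S x.K x.W x.W θ)⁻¹ :=
  ⟨M, hM, fun x θ hθ i j => by simpa using x.norm_inv_WW_le θ hθ i j⟩

theorem uniformBound_C (h𝒦 : IsCompact 𝒦) (h𝒦S : 𝒦 ⊆ S.domain) (hM : 0 ≤ M)
    {r : ℝ} (hr : r < ρ) :
    UniformBound (fun _ => 1) r fun x : ApproxTorus S h Λ ω β 𝒦 ρ M => matC S x.K x.W :=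
  have hG : UniformBound (fun _ => 1) r fun (x : ApproxTorus S h Λ ω β 𝒦 ρ M) θ => S.G (x.K θ) :=
    .mono (.comp_compact h𝒦 h𝒦S S.G_holo fun x => x.K_mem) hr.le
  (((uniformBound_inv_WW S h Λ ω β M hM).mono hr.le).bounded_mul
    ((((uniformBound_W hM).mono hr.le).transpose.bounded_mul hG).bounded_mul
      (uniformBound_L h𝒦 hr))).bounded_mul ((uniformBound_B S h Λ ω β M hM).mono hr.le)

theorem uniformBound_A (h𝒦 : IsCompact 𝒦) (h𝒦S : 𝒦 ⊆ S.domain) (hM : 0 ≤ M)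
    {r : ℝ} (hr : r < ρ) :
    UniformBound (fun _ => 1) r fun x : ApproxTorus S h Λ ω β 𝒦 ρ M => matA S x.K x.W :=
  have hC := uniformBound_C S h Λ ω β M h𝒦 h𝒦S hM hr
  have hW := (uniformBound_W (S := S) (h := h) (Λ := Λ) (ω := ω) (β := β) (𝒦 := 𝒦) (ρ := ρ)
    hM).mono hr.le
  have hΩ := (uniformBound_Ω h𝒦 h𝒦S).mono hr.le
  .smul _ ((hC.transpose.bounded_mul ((hW.transpose.bounded_mul hΩ).bounded_mul hW)).bounded_mul hC)

theorem uniformBound_N (h𝒦 : IsCompact 𝒦) (h𝒦S : 𝒦 ⊆ S.domain) (hM : 0 ≤ M)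
    {r : ℝ} (hr : r < ρ) :
    UniformBound (fun _ => 1) r fun x : ApproxTorus S h Λ ω β 𝒦 ρ M => frameN S x.K x.W :=
  have hL := uniformBound_L (S := S) (h := h) (Λ := Λ) (ω := ω) (β := β) (M := M) h𝒦 hr
  have hJ : UniformBound (fun _ => 1) r fun (x : ApproxTorus S h Λ ω β 𝒦 ρ M) θ => S.J (x.K θ) :=
    .mono (.comp_compact h𝒦 h𝒦S S.J_holo fun x => x.K_mem) hr.le
  ((hL.bounded_mul (uniformBound_A S h Λ ω β M h𝒦 h𝒦S hM hr)).add
    ((hJ.bounded_mul hL).bounded_mul ((uniformBound_B S h Λ ω β M hM).mono hr.le))).add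
    (((uniformBound_W hM).mono hr.le).bounded_mul (uniformBound_C S h Λ ω β M h𝒦 h𝒦S hM hr))

theorem uniformBound_approxInv (h𝒦 : IsCompact 𝒦) (h𝒦S : 𝒦 ⊆ S.domain) (hM : 0 ≤ M)
    {r : ℝ} (hr : r < ρ) :
    UniformBound (fun _ => 1) r fun x : ApproxTorus S h Λ ω β 𝒦 ρ M => approxInv S x.K x.W :=
  have hΩ := (uniformBound_Ω h𝒦 h𝒦S).mono hr.le
  .fromRows (fun _ => zero_le_one)
    ((uniformBound_N S h Λ ω β M h𝒦 h𝒦S hM hr).transpose.bounded_mul hΩ)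
    (.fromRows (fun _ => zero_le_one)
      ((uniformBound_L h𝒦 hr).transpose.neg.bounded_mul hΩ)
      ((((uniformBound_inv_WW S h Λ ω β M hM).mono hr.le).bounded_mul
        ((uniformBound_W hM).mono hr.le).transpose).bounded_mul hΩ))

theorem uniformBound_defect (h𝒦 : IsCompact 𝒦) (h𝒦S : 𝒦 ⊆ S.domain) (hM : 0 ≤ M) {r : ℝ}
    (hr : r < ρ) (hh : ∀ lam ∈ Λ, IsRealHolomorphicOn S.domain (h lam))
    {γ τ : ℝ} (hDM : DiophantineMelnikov ω β γ τ) :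
    UniformBound err r fun x : ApproxTorus S h Λ ω β 𝒦 ρ M => x.defect := by
  have he : ∀ x : ApproxTorus S h Λ ω β 𝒦 ρ M, 0 ≤ x.err := fun x => x.err_nonneg
  have hA := uniformBound_A S h Λ ω β M h𝒦 h𝒦S hM hr
  have hB := (uniformBound_B S h Λ ω β (𝒦 := 𝒦) (ρ := ρ) M hM).mono hr.le
  have hC := uniformBound_C S h Λ ω β M h𝒦 h𝒦S hM hr
  have hV := (uniformBound_inv_WW S h Λ ω β (𝒦 := 𝒦) (ρ := ρ) M hM).mono hr.le
  have hX := uniformBound_pairΩ_LL (M := M) hh hDM h𝒦 h𝒦S hr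
  have hY := uniformBound_pairΩ_LW (M := M) hh hDM h𝒦 h𝒦S hM hr
  have hAX := hA.transpose.bounded_mul hX
  have hAY := hA.transpose.bounded_mul hY
  have hCY := hC.transpose.bounded_mul hY.transpose
  exact .fromRows he
    (.fromCols he (hAX.sub hCY) (.fromCols he
      ((((hAX.mul_bounded hA).add (hAY.mul_bounded hC)).add
        ((hB.transpose.bounded_mul hX).mul_bounded hB)).sub (hCY.mul_bounded hA)) hAY))
    (.fromRows he
      (.fromCols he hX.neg (.fromCols he
        ((hX.mul_bounded hA).add (hY.mul_bounded hC)).neg hY.neg))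
      (.fromCols he (hV.bounded_mul hY.transpose).neg (.fromCols he
        (hV.bounded_mul (hY.transpose.mul_bounded hA)).neg .zero)))

end Bounds

/-- The correction that turns the approximate inverse of the frame into the inverse. -/
def invError (x : ApproxTorus S h Λ ω β 𝒦 ρ M) (θ : Fin d → ℂ) :
    Matrix (FrameIdx n d) (Fin (2 * n)) ℂ :=
  (approxInv S x.K x.W θ * frameP S x.K x.W θ)⁻¹ * approxInv S x.K x.W θ - approxInv S x.K x.W θ

theorem invError_torus (h𝒦S : 𝒦 ⊆ S.domain) (x : ApproxTorus S h Λ ω β 𝒦 ρ M) {r : ℝ}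
    (hr : r ≤ ρ)
    (hdet : ∀ θ ∈ strip d r, (approxInv S x.K x.W θ * frameP S x.K x.W θ).det ≠ 0)
    (i : FrameIdx n d) (j : Fin (2 * n)) : IsTorusFun r fun θ => x.invError θ i j := by
  have hA := (x.approxInv_holo h𝒦S).mono (strip_mono hr)
  have hP := (x.P_holo h𝒦S).mono (strip_mono hr)
  refine ⟨(((hA.mul hP).inv hdet).mul hA).sub hA i j, fun θ hθ l => ?_⟩
  simp only [invError, P_periodic (strip_mono hr hθ), approxInv_periodic (strip_mono hr hθ)]

theorem invError_spec (hdn : d < n) (x : ApproxTorus S h Λ ω β 𝒦 ρ M) {θ : Fin d → ℂ}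
    (hdet : (approxInv S x.K x.W θ * frameP S x.K x.W θ).det ≠ 0) :
    frameP S x.K x.W θ * (approxInv S x.K x.W θ + x.invError θ) = 1 ∧
    (approxInv S x.K x.W θ + x.invError θ) * frameP S x.K x.W θ = 1 := by
  -- `d + d + 2 (n - d) = 2 n`, where `d < n` makes the natural subtraction exact; so `P` is square
  -- and a left inverse is two-sided.
  have hcard : Fintype.card (FrameIdx n d) = Fintype.card (Fin (2 * n)) := by
    simp only [Fintype.card_sum, Fintype.card_fin]
    omega
  have h1 : (approxInv S x.K x.W θ + x.invError θ) * frameP S x.K x.W θ = 1 := by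
    rw [invError, add_sub_cancel, Matrix.mul_assoc, Matrix.nonsing_inv_mul _ hdet.isUnit]
  exact ⟨(Matrix.mul_eq_one_comm_of_card_eq _ _ _ hcard).1 h1, h1⟩

theorem exists_invError_bound (hh : ∀ lam ∈ Λ, IsRealHolomorphicOn S.domain (h lam))
    {γ τ : ℝ} (hDM : DiophantineMelnikov ω β γ τ) (h𝒦 : IsCompact 𝒦) (h𝒦S : 𝒦 ⊆ S.domain)
    (hM : 0 ≤ M)
    {r : ℝ} (hr : r < ρ) :
    ∃ ε C : ℝ≥0, 0 < ε ∧ ∀ x : ApproxTorus S h Λ ω β 𝒦 ρ M, x.err ≤ ε → ∀ θ ∈ strip d r,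
      (approxInv S x.K x.W θ * frameP S x.K x.W θ).det ≠ 0 ∧
      ∀ i j, ‖x.invError θ i j‖ ≤ C * x.err := by
  have hdef := uniformBound_defect S h Λ ω β M h𝒦 h𝒦S hM hr hh hDM
  obtain ⟨c, hc0, hc⟩ := hdef
  set m : ℝ := (Fintype.card (FrameIdx n d) : ℝ) with hm
  have hm0 : 0 ≤ m := Nat.cast_nonneg _
  -- Chosen so that the row sums of the defect stay below `1 / 2`; the `+ 1` covers `c = 0`.
  let ε : ℝ := 1 / (2 * (m * c + 1))
  have hε : 0 < ε := by positivity
  have hsmall : m * (c * ε) ≤ 1 / 2 := by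
    have : m * (c * ε) = 1 / 2 * (m * c / (m * c + 1)) := by simp only [ε]; field_simp
    rw [this]
    have h1 : m * c / (m * c + 1) ≤ 1 := (div_le_one (by positivity)).2 (by linarith)
    linarith
  have hentry : ∀ x : ApproxTorus S h Λ ω β 𝒦 ρ M, x.err ≤ ε → ∀ θ ∈ strip d r, ∀ i j,
      ‖x.defect θ i j‖ ≤ c * ε := fun x hx θ hθ i j =>
    (hc x θ hθ i j).trans (mul_le_mul_of_nonneg_left hx hc0)
  -- The bound on `(1 + D)⁻¹` holds only for small errors, so the calculus of uniform bounds is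
  -- applied to that subfamily.
  let φ : {x : ApproxTorus S h Λ ω β 𝒦 ρ M // x.err ≤ ε} → ApproxTorus S h Λ ω β 𝒦 ρ M :=
    Subtype.val
  have hinv : UniformBound (fun _ => 1) r fun x θ => (1 + (φ x).defect θ)⁻¹ :=
    ⟨2, zero_le_two, fun x θ hθ i j => by
      simpa using norm_inv_one_add_le (hentry x.1 x.2 θ hθ) hsmall i j⟩
  obtain ⟨C, hC0, hC⟩ := ((hinv.bounded_mul (UniformBound.comp φ ⟨c, hc0, hc⟩)).neg).mul_bounded
    (UniformBound.comp φ (uniformBound_approxInv S h Λ ω β M h𝒦 h𝒦S hM hr))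
  refine ⟨⟨ε, hε.le⟩, ⟨C, hC0⟩, hε, fun x hx θ hθ => ?_⟩
  have hθ' := strip_mono hr.le hθ
  have hdet := det_one_add_ne_zero (hentry x hx θ hθ) hsmall
  rw [invError, x.approxInv_mul_frameP h𝒦S hθ']
  refine ⟨hdet, fun i j => ?_⟩
  -- This form exhibits a factor of the defect, hence of the error.
  have h1 : (1 + x.defect θ)⁻¹ * approxInv S x.K x.W θ - approxInv S x.K x.W θ =
      -((1 + x.defect θ)⁻¹ * x.defect θ) * approxInv S x.K x.W θ := by
    have h2 := Matrix.nonsing_inv_mul _ hdet.isUnit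
    rw [Matrix.mul_add, Matrix.mul_one] at h2
    rw [eq_sub_of_add_eq' h2, Matrix.neg_mul, Matrix.sub_mul, Matrix.one_mul, neg_sub]
  rw [h1]
  exact hC ⟨x, hx⟩ θ hθ i j

end ApproxTorus

/-! ## Supremum norms -/

theorem norm_le_of_vecNorm_le {ι : Type} {ρ : ℝ} {f : (Fin d → ℂ) → ι → ℂ} {c : ℝ≥0}
    (hf : vecNorm ρ f ≤ c) {θ : Fin d → ℂ} (hθ : θ ∈ strip d ρ) (i : ι) : ‖f θ i‖ ≤ c := by
  have h1 : ‖f θ i‖ₑ ≤ c := (le_iSup₂_of_le (f := fun θ (_ : θ ∈ strip d ρ) => ‖f θ i‖ₑ) θ hθ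
    le_rfl).trans ((le_iSup (fun i => supNorm ρ fun θ => f θ i) i).trans hf)
  exact_mod_cast enorm_le_coe.1 h1

theorem norm_le_of_matNorm_le {ι κ : Type} {ρ : ℝ} {F : (Fin d → ℂ) → Matrix ι κ ℂ} {c : ℝ≥0}
    (hF : matNorm ρ F ≤ c) {θ : Fin d → ℂ} (hθ : θ ∈ strip d ρ) (i : ι) (j : κ) :
    ‖F θ i j‖ ≤ c :=
  norm_le_of_vecNorm_le (f := fun θ => F θ i)
    ((le_iSup (fun i => vecNorm ρ fun θ => F θ i) i).trans hF) hθ j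

theorem matNorm_le {ι κ : Type} {ρ : ℝ} {F : (Fin d → ℂ) → Matrix ι κ ℂ} {c : ℝ≥0}
    (hF : ∀ θ ∈ strip d ρ, ∀ i j, ‖F θ i j‖ ≤ c) : matNorm ρ F ≤ c :=
  iSup_le fun i => iSup_le fun j => iSup₂_le fun θ hθ =>
    enorm_le_coe.2 (by exact_mod_cast hF θ hθ i j)

end EllipticTori

end

open EllipticTori
theorem mainTheorem4 {n d : ℕ} (hdn : d < n)
    (S : CompatibleTriple n)
    (Λ : Set (Fin (n - d) → ℝ)) (h : (Fin (n - d) → ℝ) → (Fin (2 * n) → ℂ) → ℂ)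
    (hh : ∀ lam ∈ Λ, IsRealHolomorphicOn S.domain (h lam))
    (ω : Fin d → ℝ) (β : Fin (n - d) → ℝ) (γ τ : ℝ) (hDM : DiophantineMelnikov ω β γ τ)
    (𝒦 : Set (Fin (2 * n) → ℂ)) (h𝒦 : IsCompact 𝒦) (h𝒦S : 𝒦 ⊆ S.domain)
    (ρ δ : ℝ) (hδ : 0 < δ) (hδρ : δ < ρ) (M : ℝ≥0) :
    ∃ ε C : ℝ≥0, 0 < ε ∧
      ∀ (K : (Fin d → ℂ) → Fin (2 * n) → ℂ) (W : MatMap n d (NormalIdx n d))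
        (lam α : Fin (n - d) → ℝ), lam ∈ Λ →
        (∀ i, IsTorusFun ρ (fun θ => K θ i)) →
        (∀ i j, IsTorusFun ρ (fun θ => W θ i j)) →
        (∀ θ ∈ strip d ρ, K θ ∈ 𝒦) →
        (∀ θ ∈ strip d ρ, (pairG S K (frameL K) (frameL K) θ).det ≠ 0) →
        (∀ θ ∈ strip d ρ, (pairΩ S K W W θ).det ≠ 0) →
        matNorm ρ W ≤ M →
        matNorm ρ (fun θ => (pairG S K (frameL K) (frameL K) θ)⁻¹) ≤ M →
        matNorm ρ (fun θ => (pairΩ S K W W θ)⁻¹) ≤ M →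
        vecNorm ρ (errK S (h lam) ω K) + matNorm ρ (errW S (h lam) ω α β K W) ≤ ε →
        ∃ Einv : (Fin d → ℂ) → Matrix (FrameIdx n d) (Fin (2 * n)) ℂ,
          (∀ i j, IsTorusFun (ρ - δ) (fun θ => Einv θ i j)) ∧
          (∀ θ ∈ strip d (ρ - δ),
            frameP S K W θ * (approxInv S K W θ + Einv θ) = 1 ∧
            (approxInv S K W θ + Einv θ) * frameP S K W θ = 1) ∧
          matNorm (ρ - δ) Einv ≤
            C * (vecNorm ρ (errK S (h lam) ω K) + matNorm ρ (errW S (h lam) ω α β K W)) := by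
  have hr : ρ - δ < ρ := by linarith
  obtain ⟨ε, C, hε, hmain⟩ := ApproxTorus.exists_invError_bound (ω := ω) hh hDM h𝒦 h𝒦S
    M.coe_nonneg hr
  refine ⟨ε, C, hε, fun K W lam α hlam hK hW hKm hLL hWW hWM hBM hVM herr => ?_⟩
  -- The extended sum is finite, being at most `ε`; its real value `e` dominates both errors and
  -- serves as `err`.
  obtain ⟨e, he⟩ : ∃ e : ℝ≥0, (e : ℝ≥0∞) =
      vecNorm ρ (errK S (h lam) ω K) + matNorm ρ (errW S (h lam) ω α β K W) :=
    ⟨_, ENNReal.coe_toNNReal (herr.trans_lt ENNReal.coe_lt_top).ne⟩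
  rw [← he] at herr ⊢
  let x : ApproxTorus S h Λ ω β 𝒦 ρ M :=
    { K := K, W := W, lam := lam, α := α, err := e
      lam_mem := hlam
      K_torus := hK
      W_torus := hW
      K_mem := hKm
      det_LL := hLL
      det_WW := hWW
      norm_W_le := fun θ hθ => norm_le_of_matNorm_le hWM hθ
      norm_B_le := fun θ hθ => norm_le_of_matNorm_le hBM hθ
      norm_inv_WW_le := fun θ hθ => norm_le_of_matNorm_le hVM hθ
      norm_errK_le := fun θ hθ => norm_le_of_vecNorm_le (he ▸ le_self_add) hθ
      norm_errW_le := fun θ hθ => norm_le_of_matNorm_le (he ▸ le_add_self) hθ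
      err_nonneg := e.coe_nonneg }
  have hx := hmain x (by exact_mod_cast herr)
  refine ⟨x.invError, x.invError_torus h𝒦S hr.le fun θ hθ => (hx θ hθ).1,
    fun θ hθ => x.invError_spec hdn (hx θ hθ).1, ?_⟩
  rw [← ENNReal.coe_mul]
  exact matNorm_le fun θ hθ => (hx θ hθ).2
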